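/- **Setting.** Fix $D\ge 2$ and $q\ge1$. Sites are the points of a $D$-dimensional lattice with $q$ sublattices, i.e. of $\mathbb Z^D\times\{1,\dots,q\}$, on which $\mathbb Z^D$ acts by translation of the first component. Let $J_{ij}$ be real, square-integrable random couplings, one for each ordered pair of sites, such that the pairs $(J_{ij},J_{ji})$ attached to different bonds $\{i,j\}$ are independent, and the law of $(J_{ij},J_{ji})$ is invariant under translating $i$ and $j$ by a common lattice vector. (The two couplings of one bond may be equal, independent, or neither.) $[\,\cdot\,]$ denotes the average over $J$. Let $\Lambda_0,\Lambda_1,\dots$ be nonempty finite sets of sites with $|\Lambda_n|\to\infty$ and $|\Lambda_{n+1}|\le c\,|\Lambda_n|$, and suppose that the system is *finite-dimensional*: there are constants $c_{\rm bulk},c_{\rm surface},c_{\rm rem}$ such that * for every $n$ and $i\in\Lambda_n$, $\ \sum_{j\in\Lambda_n}\sqrt{[J_{ij}^2]}\le c_{\rm bulk}$; * for all $m\le n$, with $A=|\Lambda_m|$ and $N=|\Lambda_n|$, there are pairwise disjoint translates $A[1],\dots,A[B]\subseteq\Lambda_n$ of $\Lambda_m$ that cover all but at most $c_{\rm rem}A^{1/D}N^{1-1/D}$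 sites of $\Lambda_n$, and $\sum_{i\in A[k]}\sum_{j\in\Lambda_n\setminus A[k]}\sqrt{[J_{ij}^2]}\le c_{\rm surface}A^{1-1/D}$ for each $k$. (For instance, $\Lambda_n$ may be the cubes of side $n+1$ unit cells with couplings of finite range and uniformly bounded second moments.) On the $N=|\Lambda_n|$ spins-$1/2$ of $\Lambda_n$ put $$U=-\sum_{i,j\in\Lambda_n}J_{ij}\sigma^z_i\sigma^z_j,\qquad M_x=\sum_{i\in\Lambda_n}\sigma^x_i,\qquad H(\gamma;\alpha)=U-\gamma M_x+\frac{\alpha}{N}M_x^2,$$ let $E_g(\gamma)$ be the smallest eigenvalue of $U-\gamma M_x$, and let $G(H)$ be the set of unit vectors of minimal energy for $H$. **Theorem.** For every $\gamma\in\mathbb R$ the limit $e_g(\gamma)=\lim_{n\to\infty}[E_g(\gamma)]/N$ exists, and $u_g(m)=\sup_{\gamma\in\mathbb R}(e_g(\gamma)+\gamma m)$ is finite for $m\in[-1,1]$. For every $\alpha>0$ and $\gamma\in\mathbb R$ the function $m\mapsto u_g(m)+\alpha m^2-\gamma m$ has a unique minimizer $m_*(\gamma;\alpha)$ on $[-1,1]$,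 which is continuous in $\gamma$, and for every $\varepsilon>0$ $$\left[\left(\sup_{\gamma\in[0,\infty)}\ \max_{|g\rangle\in G(H(\gamma;\alpha))}\left|\frac{\langle g|M_x|g\rangle}{N}-m_*(\gamma;\alpha)\right|\right)^{2}\right]^{1/2}=O\!\left(N^{-1/(5D)+\varepsilon}\right).$$ In particular, for every $\alpha>0$ the annealing with $H(\gamma;\alpha)$ has no quantum first-order transition in transverse magnetization: the ground-state transverse magnetization density converges in mean square, uniformly over $\gamma\in[0,\infty)$ and over all ground states, to a nonrandom continuous function of $\gamma$. -/

import Mathlib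

open MeasureTheory ProbabilityTheory Filter Topology
open scoped ENNReal

namespace QAAFF

/-! ### Quantum spin-1/2 systems on a finite set of sites -/

section Quantum

variable {ι : Type*} [Fintype ι] [DecidableEq ι]

/-- Value `±1` of a classical Ising spin. -/
def spin (b : Bool) : ℂ := if b then 1 else -1

/-- The Pauli matrix `σᵢᶻ` in the computational basis (spin configurations `ι → Bool`). -/
def sigmaZ (i : ι) : Matrix (ι → Bool) (ι → Bool) ℂ :=
  Matrix.diagonal fun s => spin (s i)

/-- The Pauli matrix `σᵢˣ`: it flips the spin at `i`. -/
def sigmaX (i : ι) : Matrix (ι → Bool) (ι → Bool) ℂ :=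
  Matrix.of fun s t => if t = Function.update s i (!(s i)) then 1 else 0

/-- The classical Hamiltonian `U = - ∑ᵢ ∑ⱼ Jᵢⱼ σᵢᶻ σⱼᶻ`. -/
def classicalHam (J : ι → ι → ℝ) : Matrix (ι → Bool) (ι → Bool) ℂ :=
  -∑ i, ∑ j, (J i j : ℂ) • (sigmaZ i * sigmaZ j)

/-- The transverse magnetization `M = ∑ᵢ σᵢˣ`. -/
def transMag (ι : Type*) [Fintype ι] [DecidableEq ι] : Matrix (ι → Bool) (ι → Bool) ℂ :=
  ∑ i : ι, sigmaX i

/-- The annealing Hamiltonian `H(γ; α) = U - γ M + (α / N) M²`, where `N` is the number of sites.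
For `α = 0` it is the conventional one, `H(γ) = U - γ M`. -/
noncomputable def annealHam (J : ι → ι → ℝ) (γ α : ℝ) : Matrix (ι → Bool) (ι → Bool) ℂ :=
  classicalHam J - (γ : ℂ) • transMag ι + ((α / (Fintype.card ι : ℝ) : ℝ) : ℂ) • transMag ι ^ 2

/-- Unit vectors, i.e. pure states. -/
def IsState (ψ : (ι → Bool) → ℂ) : Prop := star ψ ⬝ᵥ ψ = 1

/-- The expectation `⟨ψ|A|ψ⟩` (real for Hermitian `A`). -/
def expect (A : Matrix (ι → Bool) (ι → Bool) ℂ) (ψ : (ι → Bool) → ℂ) : ℝ :=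
  (star ψ ⬝ᵥ A.mulVec ψ).re

/-- The set `G(A)` of ground states of `A`: the pure states of minimal energy. -/
def groundStates (A : Matrix (ι → Bool) (ι → Bool) ℂ) : Set ((ι → Bool) → ℂ) :=
  {ψ | IsState ψ ∧ ∀ φ, IsState φ → expect A ψ ≤ expect A φ}

/-- The ground-state energy of `A`. -/
noncomputable def groundEnergy (A : Matrix (ι → Bool) (ι → Bool) ℂ) : ℝ :=
  sInf {x | ∃ ψ, IsState ψ ∧ x = expect A ψ}

/-- `sup_{γ ≥ 0} max_{g ∈ G(H(γ; α))} |⟨g|M|g⟩ / N - m γ|`, as an extended nonnegative real. -/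
noncomputable def deviation (J : ι → ι → ℝ) (α : ℝ) (m : ℝ → ℝ) : ℝ≥0∞ :=
  ⨆ (γ : ℝ) (_ : 0 ≤ γ) (ψ ∈ groundStates (annealHam J γ α)),
    ENNReal.ofReal |expect (transMag ι) ψ / (Fintype.card ι : ℝ) - m γ|

end Quantum

/-! ### Lattice, quenched disorder, finite dimensionality -/

/-- Sites of a `D`-dimensional lattice with `q` sublattices: (unit cell, sublattice). -/
abbrev Site (D q : ℕ) : Type := (Fin D → ℤ) × Fin q

/-- Translation by a lattice vector; it preserves each sublattice. -/
def shift {D q : ℕ} (v : Fin D → ℤ) (i : Site D q) : Site D q := (v + i.1, i.2)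

/-- Translate of a finite region. -/
def translateRegion {D q : ℕ} (v : Fin D → ℤ) (R : Finset (Site D q)) : Finset (Site D q) :=
  R.image (shift v)

section Disorder

variable {D q : ℕ} {Ω : Type*} [MeasurableSpace Ω]

/-- Square-integrable random couplings, independent for different bonds `{i, j}`, whose law is
invariant under lattice translations. A bond `{i, j}` carries the couplings `Jᵢⱼ` and `Jⱼᵢ`; they
may coincide, be independent, or have any other joint law. -/
structure IsShiftInvariantDisorder (μ : Measure Ω) (J : Site D q → Site D q → Ω → ℝ) : Prop where
  memLp : ∀ i j, MemLp (J i j) 2 μ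
  indep : iIndepFun
    (fun (b : Sym2 (Site D q)) (ω : Ω) (p : {p : Site D q × Site D q // s(p.1, p.2) = b}) =>
      J p.1.1 p.1.2 ω) μ
  shift_law : ∀ (v : Fin D → ℤ) (i j : Site D q),
    μ.map (fun ω => (J (shift v i) (shift v j) ω, J (shift v j) (shift v i) ω)) =
      μ.map (fun ω => (J i j ω, J j i ω))

/-- The root mean square `√[Jᵢⱼ²]`. -/
noncomputable def rms (μ : Measure Ω) (X : Ω → ℝ) : ℝ := Real.sqrt (∫ ω, X ω ^ 2 ∂μ)

/-- Finite dimensionality, with spatial dimension `D`, of the systems with couplings `J` on the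
regions `Λ 0, Λ 1, …` of increasing size (open boundary condition).

* `bulk`: the interactions of any one site sum up to at most a constant.
* `decomposition`: up to a remainder, a large system splits into copies (translates) of a smaller
  one, of size `A`, and the interactions of any copy with its outside are at most
  `c_surface * A ^ (1 - 1 / D)`. In a system of `N` sites the remainder has
  `O(A ^ (1 / D) * N ^ (1 - 1 / D))` sites, the volume of a boundary layer as thick as a block;
  it can be empty only if `A` divides `N`.

The sizes `N = |Λ n|` tend to infinity and leave no gaps of unbounded ratio. -/
structure IsFiniteDimensional (μ : Measure Ω) (J : Site D q → Site D q → Ω → ℝ)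
    (Λ : ℕ → Finset (Site D q)) : Prop where
  nonempty : ∀ n, (Λ n).Nonempty
  card_tendsto : Tendsto (fun n => (Λ n).card) atTop atTop
  card_succ_le : ∃ c : ℝ, ∀ n, ((Λ (n + 1)).card : ℝ) ≤ c * (Λ n).card
  bulk : ∃ c_bulk : ℝ, ∀ n, ∀ i ∈ Λ n, ∑ j ∈ Λ n, rms μ (J i j) ≤ c_bulk
  decomposition : ∃ c_surface c_rem : ℝ, ∀ m n, m ≤ n → ∃ V : Finset (Fin D → ℤ),
    (∀ v ∈ V, translateRegion v (Λ m) ⊆ Λ n) ∧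
    (∀ v ∈ V, ∀ w ∈ V, v ≠ w → Disjoint (translateRegion v (Λ m)) (translateRegion w (Λ m))) ∧
    (∀ v ∈ V, ∑ i ∈ translateRegion v (Λ m), ∑ j ∈ Λ n \ translateRegion v (Λ m), rms μ (J i j) ≤
      c_surface * ((Λ m).card : ℝ) ^ (1 - 1 / (D : ℝ))) ∧
    ((Λ n \ V.biUnion fun v => translateRegion v (Λ m)).card : ℝ) ≤
      c_rem * ((Λ m).card : ℝ) ^ (1 / (D : ℝ)) * ((Λ n).card : ℝ) ^ (1 - 1 / (D : ℝ))

/-- The couplings of the finite system on the region `R`, for the disorder realization `ω`. -/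
def restrictCouplings (J : Site D q → Site D q → Ω → ℝ) (R : Finset (Site D q)) (ω : Ω) : R → R → ℝ :=
  fun i j => J i j ω

/-- The annealing with Hamiltonian `U - γ M + (α / N) M²` has no quantum first-order transition in
transverse magnetization: the ground-state transverse magnetization density converges, uniformly
in `γ ≥ 0` and over all ground states, in mean square to a nonrandom continuous function. -/
def NoQFOT (μ : Measure Ω) (J : Site D q → Site D q → Ω → ℝ) (Λ : ℕ → Finset (Site D q))
    (α : ℝ) : Prop :=
  ∃ m : ℝ → ℝ, ContinuousOn m (Set.Ici 0) ∧
    (∀ n, AEMeasurable (fun ω => deviation (restrictCouplings J (Λ n) ω) α m) μ) ∧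
    Tendsto (fun n => ∫⁻ ω, deviation (restrictCouplings J (Λ n) ω) α m ^ 2 ∂μ) atTop (𝓝 0)

end Disorder

end QAAFF

set_option linter.unusedSectionVars false

namespace QAAFF

section Basics

variable {ι : Type*} [Fintype ι] [DecidableEq ι]

/-- The configuration `s` with the spin at `i` reversed. -/
def flip (i : ι) (s : ι → Bool) : ι → Bool := Function.update s i (!(s i))

/-- Real value `±1` of a classical Ising spin. -/
def sgn (b : Bool) : ℝ := if b then 1 else -1

/-- The correlation `⟨σᵢᶻ σⱼᶻ⟩`. -/
noncomputable def corrZ (i j : ι) (ψ : (ι → Bool) → ℂ) : ℝ :=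
  ∑ s, ‖ψ s‖ ^ 2 * (sgn (s i) * sgn (s j))

/-- The complex number `⟨ψ|σᵢˣ|ψ⟩`. -/
noncomputable def meanX (i : ι) (ψ : (ι → Bool) → ℂ) : ℂ :=
  ∑ s, star (ψ s) * ψ (flip i s)

/-- The correlation `⟨σᵢˣ σⱼˣ⟩`. -/
noncomputable def corrX (i j : ι) (ψ : (ι → Bool) → ℂ) : ℝ :=
  (∑ s, star (ψ s) * ψ (flip j (flip i s))).re

/-- The energy `⟨ψ|U|ψ⟩`. -/
noncomputable def energyZ (J : ι → ι → ℝ) (ψ : (ι → Bool) → ℂ) : ℝ :=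
  -∑ i, ∑ j, J i j * corrZ i j ψ

/-- The magnetization `⟨ψ|M|ψ⟩`. -/
noncomputable def magX (ψ : (ι → Bool) → ℂ) : ℝ := ∑ i, (meanX i ψ).re

theorem flip_flip (i : ι) (s : ι → Bool) : flip i (flip i s) = s := by
  ext j; by_cases h : j = i
  · subst h; simp [flip]
  · simp [flip, h]

/-- Reversal of one spin as a permutation of the configurations. -/
def flipEquiv (i : ι) : Equiv.Perm (ι → Bool) := ⟨flip i, flip i, flip_flip i, flip_flip i⟩

theorem abs_sgn_mul_sgn (a b : Bool) : |sgn a * sgn b| = 1 := by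
  cases a <;> cases b <;> simp [sgn]

theorem isState_iff (ψ : (ι → Bool) → ℂ) : IsState ψ ↔ ∑ s, ‖ψ s‖ ^ 2 = 1 := by
  have : star ψ ⬝ᵥ ψ = ((∑ s, ‖ψ s‖ ^ 2 : ℝ) : ℂ) := by
    simp only [dotProduct, Pi.star_apply, RCLike.star_def]
    push_cast
    exact Finset.sum_congr rfl fun s _ => Complex.conj_mul' _
  rw [IsState, this]
  exact_mod_cast Iff.rfl

theorem expect_add (A B : Matrix (ι → Bool) (ι → Bool) ℂ) (ψ) :
    expect (A + B) ψ = expect A ψ + expect B ψ := by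
  simp [expect, Matrix.add_mulVec, dotProduct_add]

theorem expect_neg (A : Matrix (ι → Bool) (ι → Bool) ℂ) (ψ) :
    expect (-A) ψ = -expect A ψ := by
  simp [expect, Matrix.neg_mulVec]

theorem expect_smul (r : ℝ) (A : Matrix (ι → Bool) (ι → Bool) ℂ) (ψ) :
    expect ((r : ℂ) • A) ψ = r * expect A ψ := by
  simp [expect, Matrix.smul_mulVec, dotProduct_smul]

theorem expect_sum {κ : Type*} (t : Finset κ) (A : κ → Matrix (ι → Bool) (ι → Bool) ℂ) (ψ) :
    expect (∑ k ∈ t, A k) ψ = ∑ k ∈ t, expect (A k) ψ := by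
  classical
  induction t using Finset.induction_on with
  | empty => simp [expect]
  | insert a s ha ih => rw [Finset.sum_insert ha, Finset.sum_insert ha, expect_add, ih]

theorem expect_sigmaZ_mul (i j : ι) (ψ) :
    expect (sigmaZ i * sigmaZ j) ψ = corrZ i j ψ := by
  have h (a b : Bool) : spin a * spin b = ((sgn a * sgn b : ℝ) : ℂ) := by
    cases a <;> cases b <;> simp [spin, sgn]
  simp only [expect, sigmaZ, Matrix.diagonal_mul_diagonal, dotProduct, Matrix.mulVec_diagonal,
    Complex.re_sum, corrZ, h]
  refine Finset.sum_congr rfl fun s _ => ?_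
  rw [mul_left_comm, Pi.star_apply, RCLike.star_def, Complex.conj_mul', ← Complex.ofReal_pow,
    ← Complex.ofReal_mul, Complex.ofReal_re, mul_comm]

theorem sigmaX_mulVec (i : ι) (ψ : (ι → Bool) → ℂ) (s) :
    (sigmaX i).mulVec ψ s = ψ (flip i s) := by
  simp [sigmaX, Matrix.mulVec, dotProduct, flip]

theorem expect_sigmaX (i : ι) (ψ) : expect (sigmaX i) ψ = (meanX i ψ).re := by
  simp [expect, meanX, dotProduct, sigmaX_mulVec]

theorem expect_sigmaX_mul (i j : ι) (ψ) : expect (sigmaX i * sigmaX j) ψ = corrX i j ψ := by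
  simp only [expect, corrX, dotProduct, ← Matrix.mulVec_mulVec, sigmaX_mulVec, Pi.star_apply]

theorem expect_classicalHam (J : ι → ι → ℝ) (ψ) : expect (classicalHam J) ψ = energyZ J ψ := by
  simp only [classicalHam, expect_neg, expect_sum, expect_smul, expect_sigmaZ_mul, energyZ]

theorem expect_transMag (ψ : (ι → Bool) → ℂ) : expect (transMag ι) ψ = magX ψ := by
  simp only [transMag, expect_sum, expect_sigmaX, magX]

theorem expect_transMag_sq (ψ : (ι → Bool) → ℂ) :
    expect (transMag ι ^ 2) ψ = ∑ i, ∑ j, corrX i j ψ := by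
  simp only [transMag, sq, Finset.sum_mul_sum, expect_sum, expect_sigmaX_mul]

theorem expect_annealHam (J : ι → ι → ℝ) (γ α : ℝ) (ψ) :
    expect (annealHam J γ α) ψ = energyZ J ψ - γ * magX ψ +
      α / (Fintype.card ι : ℝ) * ∑ i, ∑ j, corrX i j ψ := by
  rw [annealHam, sub_eq_add_neg, expect_add, expect_add, expect_neg, expect_smul, expect_smul,
    expect_classicalHam, expect_transMag, expect_transMag_sq, ← sub_eq_add_neg]

theorem expect_annealHam_zero (J : ι → ι → ℝ) (γ : ℝ) (ψ) :
    expect (annealHam J γ 0) ψ = energyZ J ψ - γ * magX ψ := by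
  simp [expect_annealHam]

theorem abs_corrZ_le {ψ : (ι → Bool) → ℂ} (hψ : IsState ψ) (i j : ι) : |corrZ i j ψ| ≤ 1 := by
  rw [← (isState_iff ψ).1 hψ, corrZ]
  refine (Finset.abs_sum_le_sum_abs _ _).trans (Finset.sum_le_sum fun s _ => ?_)
  rw [abs_mul, abs_sgn_mul_sgn, mul_one, abs_of_nonneg (by positivity)]

theorem abs_re_sum_le {ψ : (ι → Bool) → ℂ} (hψ : IsState ψ) (e : Equiv.Perm (ι → Bool)) :
    |(∑ s, star (ψ s) * ψ (e s)).re| ≤ 1 := by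
  have h1 := (isState_iff ψ).1 hψ
  have h2 : ∑ s, ‖ψ (e s)‖ ^ 2 = 1 := by
    rw [← h1]; exact Equiv.sum_comp e fun s => ‖ψ s‖ ^ 2
  refine (Complex.abs_re_le_norm _).trans ((norm_sum_le _ _).trans ?_)
  calc ∑ s, ‖star (ψ s) * ψ (e s)‖ ≤ ∑ s, (‖ψ s‖ ^ 2 + ‖ψ (e s)‖ ^ 2) / 2 := by
        refine Finset.sum_le_sum fun s _ => ?_
        rw [norm_mul, norm_star]
        nlinarith [sq_nonneg (‖ψ s‖ - ‖ψ (e s)‖)]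
    _ = 1 := by rw [← Finset.sum_div, Finset.sum_add_distrib, h1, h2]; norm_num

theorem abs_meanX_le {ψ : (ι → Bool) → ℂ} (hψ : IsState ψ) (i : ι) : |(meanX i ψ).re| ≤ 1 :=
  abs_re_sum_le hψ (flipEquiv i)

theorem abs_corrX_le {ψ : (ι → Bool) → ℂ} (hψ : IsState ψ) (i j : ι) : |corrX i j ψ| ≤ 1 :=
  abs_re_sum_le hψ ((flipEquiv i).trans (flipEquiv j))

theorem abs_magX_le {ψ : (ι → Bool) → ℂ} (hψ : IsState ψ) : |magX ψ| ≤ Fintype.card ι := by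
  refine (Finset.abs_sum_le_sum_abs _ _).trans
    ((Finset.sum_le_sum fun i _ => abs_meanX_le hψ i).trans ?_)
  simp

theorem star_meanX (i : ι) (ψ : (ι → Bool) → ℂ) : star (meanX i ψ) = meanX i ψ := by
  rw [meanX, star_sum, ← Equiv.sum_comp (flipEquiv i)]
  refine Finset.sum_congr rfl fun s _ => ?_
  simp only [flipEquiv, Equiv.coe_fn_mk, flip_flip, star_mul', star_star]
  ring

theorem meanX_eq_re (i : ι) (ψ : (ι → Bool) → ℂ) : meanX i ψ = ((meanX i ψ).re : ℂ) :=
  (Complex.conj_eq_iff_re.1 (star_meanX i ψ)).symm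

theorem abs_energyZ_sub_le {ψ : (ι → Bool) → ℂ} (hψ : IsState ψ) (J J' : ι → ι → ℝ) :
    |energyZ J ψ - energyZ J' ψ| ≤ ∑ i, ∑ j, |J i j - J' i j| := by
  have : energyZ J ψ - energyZ J' ψ = -∑ i, ∑ j, (J i j - J' i j) * corrZ i j ψ := by
    simp only [energyZ, sub_mul, Finset.sum_sub_distrib]; ring
  rw [this, abs_neg]
  refine (Finset.abs_sum_le_sum_abs _ _).trans (Finset.sum_le_sum fun i _ => ?_)
  refine (Finset.abs_sum_le_sum_abs _ _).trans (Finset.sum_le_sum fun j _ => ?_)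
  rw [abs_mul]
  exact mul_le_of_le_one_right (abs_nonneg _) (abs_corrZ_le hψ i j)

theorem energyZ_zero (ψ : (ι → Bool) → ℂ) : energyZ (fun _ _ => 0) ψ = 0 := by simp [energyZ]

theorem abs_energyZ_le {ψ : (ι → Bool) → ℂ} (hψ : IsState ψ) (J : ι → ι → ℝ) :
    |energyZ J ψ| ≤ ∑ i, ∑ j, |J i j| := by
  simpa [energyZ_zero] using abs_energyZ_sub_le hψ J (fun _ _ => 0)

/-- The second moment of the magnetization is at least the square of its mean. -/
theorem sq_magX_le {ψ : (ι → Bool) → ℂ} (hψ : IsState ψ) :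
    magX ψ ^ 2 ≤ ∑ i, ∑ j, corrX i j ψ := by
  have key : ∑ s, ‖∑ i, ψ (flip i s) - (magX ψ : ℂ) * ψ s‖ ^ 2 =
      ∑ i, ∑ j, corrX i j ψ - magX ψ ^ 2 := by
    have h (s) : ‖∑ i, ψ (flip i s) - (magX ψ : ℂ) * ψ s‖ ^ 2 =
        (star (∑ i, ψ (flip i s)) * ∑ j, ψ (flip j s)).re
          - 2 * magX ψ * (star (ψ s) * ∑ i, ψ (flip i s)).re + magX ψ ^ 2 * ‖ψ s‖ ^ 2 := by
      generalize (∑ i, ψ (flip i s)) = a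
      generalize magX ψ = m
      generalize ψ s = b
      rw [← Complex.normSq_eq_norm_sq, ← Complex.normSq_eq_norm_sq]
      simp [Complex.normSq_apply]
      ring
    simp only [h, Finset.sum_add_distrib, Finset.sum_sub_distrib]
    rw [← Finset.mul_sum, ← Finset.mul_sum, (isState_iff ψ).1 hψ]
    have h1 : ∑ s, (star (∑ i, ψ (flip i s)) * ∑ j, ψ (flip j s)).re =
        ∑ i, ∑ j, corrX i j ψ := by
      simp only [star_sum, Finset.sum_mul_sum, Complex.re_sum]
      rw [Finset.sum_comm]
      refine Finset.sum_congr rfl fun i _ => ?_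
      rw [Finset.sum_comm]
      refine Finset.sum_congr rfl fun j _ => ?_
      rw [corrX, Complex.re_sum, ← Equiv.sum_comp (flipEquiv i)]
      refine Finset.sum_congr rfl fun s _ => ?_
      simp [flipEquiv, flip_flip]
    have h2 : ∑ s, (star (ψ s) * ∑ i, ψ (flip i s)).re = magX ψ := by
      simp only [Finset.mul_sum, Complex.re_sum, magX, meanX]
      rw [Finset.sum_comm]
    rw [h1, h2]; ring
  have : 0 ≤ ∑ s, ‖∑ i, ψ (flip i s) - (magX ψ : ℂ) * ψ s‖ ^ 2 :=
    Finset.sum_nonneg fun _ _ => by positivity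
  linarith

/-- The uniform state, with signs so that every `σᵢˣ` has the value `ε = ±1`. -/
theorem exists_isState_magX_eq {ε : ℝ} (hε : ε ^ 2 = 1) :
    ∃ ψ : (ι → Bool) → ℂ, IsState ψ ∧ magX ψ = ε * Fintype.card ι := by
  have hε0 : ε * ε = 1 := by rw [← sq, hε]
  set c : ℝ := (Real.sqrt (Fintype.card (ι → Bool)))⁻¹ with hc
  have hc2 : (Fintype.card (ι → Bool) : ℝ) * (c * c) = 1 := by
    have h0 : (0 : ℝ) < Fintype.card (ι → Bool) := by exact_mod_cast Fintype.card_pos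
    rw [hc, ← mul_inv, Real.mul_self_sqrt h0.le, mul_inv_cancel₀ h0.ne']
  let φ : (ι → Bool) → ℝ := fun s => c * ∏ i, if s i then 1 else ε
  have hsq (s) : φ s * φ s = c * c := by
    have : (∏ i, if s i then 1 else ε) * (∏ i, if s i then 1 else ε) = 1 := by
      rw [← Finset.prod_mul_distrib]
      refine Finset.prod_eq_one fun i _ => ?_
      split_ifs <;> simp [hε0]
    calc φ s * φ s = c * c * ((∏ i, if s i then 1 else ε) * (∏ i, if s i then 1 else ε)) := by
          simp only [φ]; ring
      _ = c * c := by rw [this, mul_one]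
  have hflip (i s) : φ (flip i s) = ε * φ s := by
    simp only [φ]
    rw [← Finset.mul_prod_erase _ _ (Finset.mem_univ i),
      ← Finset.mul_prod_erase _ (fun j => if s j then 1 else ε) (Finset.mem_univ i)]
    have : ∏ x ∈ Finset.univ.erase i, (if flip i s x then 1 else ε) =
        ∏ x ∈ Finset.univ.erase i, (if s x then 1 else ε) := by
      refine Finset.prod_congr rfl fun j hj => ?_
      simp [flip, Finset.ne_of_mem_erase hj]
    rw [this]
    cases h : s i
    · simp [flip, h]; rw [mul_left_comm, ← mul_assoc ε ε, hε0, one_mul]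
    · simp [flip, h]; ring
  have hst : IsState fun s => (φ s : ℂ) := by
    rw [isState_iff]
    simp only [Complex.norm_real, Real.norm_eq_abs, sq_abs]
    simp only [sq, hsq]
    simpa using hc2
  refine ⟨fun s => (φ s : ℂ), hst, ?_⟩
  have hm (i) : meanX i (fun s => (φ s : ℂ)) = ε := by
    simp only [meanX, hflip, RCLike.star_def, Complex.conj_ofReal]
    have h3 (s) : (φ s : ℂ) * ((ε * φ s : ℝ) : ℂ) = ((ε * (c * c) : ℝ) : ℂ) := by
      rw [← hsq s]; push_cast; ring
    simp only [h3, Finset.sum_const, Finset.card_univ, nsmul_eq_mul]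
    rw [← Complex.ofReal_natCast, ← Complex.ofReal_mul]
    congr 1
    linear_combination ε * hc2
  simp [magX, hm, mul_comm]

theorem bddBelow_expect (A : Matrix (ι → Bool) (ι → Bool) ℂ) :
    BddBelow {x | ∃ ψ, IsState ψ ∧ x = expect A ψ} := by
  refine ⟨-∑ s, ∑ t, ‖A s t‖, ?_⟩
  rintro _ ⟨ψ, hψ, rfl⟩
  have h1 (s) : ‖ψ s‖ ≤ 1 := by
    have := (isState_iff ψ).1 hψ
    have h2 : ‖ψ s‖ ^ 2 ≤ ∑ s, ‖ψ s‖ ^ 2 :=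
      Finset.single_le_sum (f := fun s => ‖ψ s‖ ^ 2) (fun _ _ => by positivity) (Finset.mem_univ s)
    rw [this] at h2
    nlinarith [norm_nonneg (ψ s)]
  have : |expect A ψ| ≤ ∑ s, ∑ t, ‖A s t‖ := by
    refine (Complex.abs_re_le_norm _).trans ((norm_sum_le _ _).trans
      (Finset.sum_le_sum fun s _ => ?_))
    rw [norm_mul, Pi.star_apply, norm_star]
    refine (mul_le_of_le_one_left (norm_nonneg _) (h1 s)).trans ((norm_sum_le _ _).trans
      (Finset.sum_le_sum fun t _ => ?_))
    rw [norm_mul]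
    exact mul_le_of_le_one_right (norm_nonneg _) (h1 t)
  linarith [neg_abs_le (expect A ψ)]

theorem groundEnergy_le (A : Matrix (ι → Bool) (ι → Bool) ℂ) {ψ} (hψ : IsState ψ) :
    groundEnergy A ≤ expect A ψ := csInf_le (bddBelow_expect A) ⟨ψ, hψ, rfl⟩

theorem le_groundEnergy (A : Matrix (ι → Bool) (ι → Bool) ℂ) {c : ℝ}
    (h : ∀ ψ, IsState ψ → c ≤ expect A ψ) : c ≤ groundEnergy A := by
  obtain ⟨ψ, hψ, -⟩ := exists_isState_magX_eq (ι := ι) (ε := 1) (by norm_num)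
  refine le_csInf ⟨_, ψ, hψ, rfl⟩ ?_
  rintro _ ⟨φ, hφ, rfl⟩
  exact h φ hφ

theorem expect_eq_groundEnergy {A : Matrix (ι → Bool) (ι → Bool) ℂ} {ψ}
    (h : ψ ∈ groundStates A) : expect A ψ = groundEnergy A :=
  le_antisymm (le_groundEnergy A h.2) (groundEnergy_le A h.1)

/-- The ground-state energy of `U - γ M`. -/
noncomputable def gsE (J : ι → ι → ℝ) (γ : ℝ) : ℝ := groundEnergy (annealHam J γ 0)

theorem gsE_le {J : ι → ι → ℝ} {γ : ℝ} {ψ} (hψ : IsState ψ) :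
    gsE J γ ≤ energyZ J ψ - γ * magX ψ := by
  rw [← expect_annealHam_zero]; exact groundEnergy_le _ hψ

theorem le_gsE {J : ι → ι → ℝ} {γ c : ℝ}
    (h : ∀ ψ, IsState ψ → c ≤ energyZ J ψ - γ * magX ψ) : c ≤ gsE J γ :=
  le_groundEnergy _ fun ψ hψ => by rw [expect_annealHam_zero]; exact h ψ hψ

theorem gsE_sub_le (J J' : ι → ι → ℝ) (γ : ℝ) :
    gsE J γ ≤ gsE J' γ + ∑ i, ∑ j, |J i j - J' i j| := by
  rw [← sub_le_iff_le_add]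
  refine le_gsE fun ψ hψ => ?_
  have h1 := gsE_le (J := J) (γ := γ) hψ
  have h2 := (abs_le.1 (abs_energyZ_sub_le hψ J J')).2
  linarith

theorem abs_gsE_sub_le (J J' : ι → ι → ℝ) (γ : ℝ) :
    |gsE J γ - gsE J' γ| ≤ ∑ i, ∑ j, |J i j - J' i j| := by
  rw [abs_le]
  have h1 := gsE_sub_le J J' γ
  have h2 := gsE_sub_le J' J γ
  simp only [abs_sub_comm (J' _ _)] at h2
  constructor <;> linarith

theorem continuous_gsE (γ : ℝ) : Continuous fun J : ι → ι → ℝ => gsE J γ := by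
  refine continuous_iff_continuousAt.2 fun J => ?_
  rw [ContinuousAt, tendsto_iff_dist_tendsto_zero]
  have h : Tendsto (fun J' : ι → ι → ℝ => ∑ i, ∑ j, |J' i j - J i j|) (𝓝 J) (𝓝 0) := by
    have : Continuous fun J' : ι → ι → ℝ => ∑ i, ∑ j, |J' i j - J i j| := by fun_prop
    simpa using this.tendsto J
  exact squeeze_zero (fun _ => dist_nonneg) (fun J' => abs_gsE_sub_le J' J γ) h

theorem abs_gsE_add_le (J : ι → ι → ℝ) (γ : ℝ) :
    |gsE J γ + |γ| * Fintype.card ι| ≤ ∑ i, ∑ j, |J i j| := by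
  rw [abs_le]
  constructor
  · suffices h : -(∑ i, ∑ j, |J i j|) - |γ| * Fintype.card ι ≤ gsE J γ by linarith
    refine le_gsE fun ψ hψ => ?_
    have h1 := (abs_le.1 (abs_energyZ_le hψ J)).1
    have h2 : γ * magX ψ ≤ |γ| * Fintype.card ι := by
      refine (le_abs_self _).trans ?_
      rw [abs_mul]
      exact mul_le_mul_of_nonneg_left (abs_magX_le hψ) (abs_nonneg _)
    linarith
  · obtain ⟨ε, hε, hγ⟩ : ∃ ε : ℝ, ε ^ 2 = 1 ∧ γ * ε = |γ| := by
      rcases le_total 0 γ with h | h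
      · exact ⟨1, by norm_num, by rw [abs_of_nonneg h, mul_one]⟩
      · exact ⟨-1, by norm_num, by rw [abs_of_nonpos h]; ring⟩
    obtain ⟨ψ, hψ, hm⟩ := exists_isState_magX_eq (ι := ι) hε
    have h1 := gsE_le (J := J) (γ := γ) hψ
    have h2 := (abs_le.1 (abs_energyZ_le hψ J)).2
    rw [hm, ← mul_assoc, hγ] at h1
    linarith

theorem monotone_gsE_add (J : ι → ι → ℝ) : Monotone fun γ => gsE J γ + γ * Fintype.card ι := by
  intro a b hab
  dsimp only
  suffices h : gsE J a + (a - b) * Fintype.card ι ≤ gsE J b by linarith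
  refine le_gsE fun ψ hψ => ?_
  have h1 := gsE_le (J := J) (γ := a) hψ
  have h2 := (abs_le.1 (abs_magX_le hψ)).2
  nlinarith

theorem antitone_gsE_sub (J : ι → ι → ℝ) : Antitone fun γ => gsE J γ - γ * Fintype.card ι := by
  intro a b hab
  dsimp only
  suffices h : gsE J b - (b - a) * Fintype.card ι ≤ gsE J a by linarith
  refine le_gsE fun ψ hψ => ?_
  have h1 := gsE_le (J := J) (γ := b) hψ
  have h2 := (abs_le.1 (abs_magX_le hψ)).1
  nlinarith

theorem concaveOn_gsE (J : ι → ι → ℝ) : ConcaveOn ℝ Set.univ (gsE J) := by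
  refine ⟨convex_univ, fun x _ y _ a b ha hb hab => le_gsE fun ψ hψ => ?_⟩
  have h1 := mul_le_mul_of_nonneg_left (gsE_le (J := J) (γ := x) hψ) ha
  have h2 := mul_le_mul_of_nonneg_left (gsE_le (J := J) (γ := y) hψ) hb
  simp only [smul_eq_mul]
  calc _ ≤ _ := add_le_add h1 h2
    _ = (a + b) * energyZ J ψ - (a * x + b * y) * magX ψ := by ring
    _ = _ := by rw [hab, one_mul]

end Basics

section Reindex

variable {ι ι' : Type*} [Fintype ι] [DecidableEq ι] [Fintype ι'] [DecidableEq ι']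

theorem flip_comp_equiv (e : ι ≃ ι') (i : ι) (s : ι' → Bool) :
    flip i (s ∘ e) = flip (e i) s ∘ e := by
  ext j; simp [flip, Function.update_apply]

theorem isState_reindex (e : ι ≃ ι') {ψ : (ι → Bool) → ℂ} (hψ : IsState ψ) :
    IsState fun s : ι' → Bool => ψ (s ∘ e) := by
  rw [isState_iff] at hψ ⊢
  rw [← hψ]
  exact Equiv.sum_comp (Equiv.arrowCongr e.symm (Equiv.refl Bool)) fun s => ‖ψ s‖ ^ 2

theorem corrZ_reindex (e : ι ≃ ι') (ψ : (ι → Bool) → ℂ) (i j : ι) :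
    corrZ (e i) (e j) (fun s : ι' → Bool => ψ (s ∘ e)) = corrZ i j ψ :=
  Equiv.sum_comp (Equiv.arrowCongr e.symm (Equiv.refl Bool))
    fun s => ‖ψ s‖ ^ 2 * (sgn (s i) * sgn (s j))

theorem meanX_reindex (e : ι ≃ ι') (ψ : (ι → Bool) → ℂ) (i : ι) :
    meanX (e i) (fun s : ι' → Bool => ψ (s ∘ e)) = meanX i ψ := by
  simp only [meanX, ← flip_comp_equiv]
  exact Equiv.sum_comp (Equiv.arrowCongr e.symm (Equiv.refl Bool))
    fun s => star (ψ s) * ψ (flip i s)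

theorem corrX_reindex (e : ι ≃ ι') (ψ : (ι → Bool) → ℂ) (i j : ι) :
    corrX (e i) (e j) (fun s : ι' → Bool => ψ (s ∘ e)) = corrX i j ψ := by
  simp only [corrX, ← flip_comp_equiv]
  congr 1
  exact Equiv.sum_comp (Equiv.arrowCongr e.symm (Equiv.refl Bool))
    fun s => star (ψ s) * ψ (flip j (flip i s))

theorem expect_annealHam_reindex (e : ι ≃ ι') (J : ι' → ι' → ℝ) (γ α : ℝ)
    (ψ : (ι → Bool) → ℂ) :
    expect (annealHam J γ α) (fun s : ι' → Bool => ψ (s ∘ e)) =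
      expect (annealHam (fun i j => J (e i) (e j)) γ α) ψ := by
  simp only [expect_annealHam, energyZ, magX, ← e.sum_comp, corrZ_reindex, meanX_reindex,
    corrX_reindex, Fintype.card_congr e]

theorem groundEnergy_le_reindex (e : ι ≃ ι') (J : ι' → ι' → ℝ) (γ α : ℝ) :
    groundEnergy (annealHam J γ α) ≤ groundEnergy (annealHam (fun i j => J (e i) (e j)) γ α) :=
  le_groundEnergy _ fun ψ hψ => by
    rw [← expect_annealHam_reindex]; exact groundEnergy_le _ (isState_reindex e hψ)

theorem groundEnergy_reindex (e : ι ≃ ι') (J : ι' → ι' → ℝ) (γ α : ℝ) :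
    groundEnergy (annealHam (fun i j => J (e i) (e j)) γ α) = groundEnergy (annealHam J γ α) := by
  refine le_antisymm ?_ (groundEnergy_le_reindex e J γ α)
  have := groundEnergy_le_reindex e.symm (fun i j => J (e i) (e j)) γ α
  simpa using this

theorem gsE_reindex (e : ι ≃ ι') (J : ι' → ι' → ℝ) (γ : ℝ) :
    gsE (fun i j => J (e i) (e j)) γ = gsE J γ := groundEnergy_reindex e J γ 0

end Reindex

section Scaling

variable {ι : Type*} [Fintype ι] [DecidableEq ι]

theorem corrZ_smul (i j : ι) (c : ℝ) (ψ : (ι → Bool) → ℂ) :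
    corrZ i j ((c : ℂ) • ψ) = c ^ 2 * corrZ i j ψ := by
  simp only [corrZ, Finset.mul_sum]
  refine Finset.sum_congr rfl fun s _ => ?_
  simp only [Pi.smul_apply, smul_eq_mul, norm_mul, Complex.norm_real, mul_pow, Real.norm_eq_abs,
    sq_abs]
  ring

theorem meanX_smul (i : ι) (c : ℝ) (ψ : (ι → Bool) → ℂ) :
    meanX i ((c : ℂ) • ψ) = (c ^ 2 : ℝ) * meanX i ψ := by
  simp only [meanX, Finset.mul_sum]
  refine Finset.sum_congr rfl fun s _ => ?_
  simp only [Pi.smul_apply, smul_eq_mul, star_mul', RCLike.star_def, Complex.conj_ofReal]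
  push_cast; ring

theorem energyZ_smul (J : ι → ι → ℝ) (c : ℝ) (ψ : (ι → Bool) → ℂ) :
    energyZ J ((c : ℂ) • ψ) = c ^ 2 * energyZ J ψ := by
  simp only [energyZ, corrZ_smul, mul_neg, Finset.mul_sum, mul_left_comm]

theorem magX_smul (c : ℝ) (ψ : (ι → Bool) → ℂ) :
    magX ((c : ℂ) • ψ) = c ^ 2 * magX ψ := by
  simp only [magX, meanX_smul, Finset.mul_sum, Complex.re_ofReal_mul]

/-- The variational bound for vectors that need not be normalized. -/
theorem gsE_mul_le (J : ι → ι → ℝ) (γ : ℝ) (φ : (ι → Bool) → ℂ) :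
    gsE J γ * ∑ s, ‖φ s‖ ^ 2 ≤ energyZ J φ - γ * magX φ := by
  rcases (Finset.sum_nonneg fun s _ => sq_nonneg ‖φ s‖ : 0 ≤ ∑ s, ‖φ s‖ ^ 2).eq_or_lt with h | h
  · have h0 : φ = 0 := by
      ext s
      have := (Finset.sum_eq_zero_iff_of_nonneg fun s _ => sq_nonneg ‖φ s‖).1 h.symm s
        (Finset.mem_univ s)
      simpa using this
    have h1 : φ = ((0 : ℝ) : ℂ) • φ := by simp [h0]
    rw [← h, h1, energyZ_smul, magX_smul]
    simp
  · set n := ∑ s, ‖φ s‖ ^ 2 with hn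
    set c := (Real.sqrt n)⁻¹ with hc
    have hc2 : c ^ 2 = n⁻¹ := by rw [hc, inv_pow, Real.sq_sqrt h.le]
    have hst : IsState ((c : ℂ) • φ) := by
      rw [isState_iff]
      simp only [Pi.smul_apply, smul_eq_mul, norm_mul, Complex.norm_real, mul_pow,
        Real.norm_eq_abs, sq_abs, ← Finset.mul_sum]
      rw [← hn, hc2, inv_mul_cancel₀ h.ne']
    have h1 := gsE_le (J := J) (γ := γ) hst
    rw [energyZ_smul, magX_smul, hc2] at h1
    calc gsE J γ * n ≤ (n⁻¹ * energyZ J φ - γ * (n⁻¹ * magX φ)) * n :=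
          mul_le_mul_of_nonneg_right h1 h.le
      _ = energyZ J φ - γ * magX φ := by field_simp

theorem continuous_energyZ (J : ι → ι → ℝ) : Continuous (energyZ J) := by
  unfold energyZ corrZ; fun_prop

theorem continuous_magX : Continuous (magX (ι := ι)) := by
  unfold magX meanX
  refine continuous_finsetSum _ fun i _ => Complex.continuous_re.comp ?_
  exact continuous_finsetSum _ fun s _ =>
    (continuous_star.comp (continuous_apply s)).mul (continuous_apply _)

theorem isCompact_isState : IsCompact {ψ : (ι → Bool) → ℂ | IsState ψ} := by
  refine Metric.isCompact_of_isClosed_isBounded ?_ ?_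
  · simp only [isState_iff]
    exact isClosed_eq (by fun_prop) continuous_const
  · refine (Metric.isBounded_closedBall (x := (0 : (ι → Bool) → ℂ)) (r := 1)).subset
      fun ψ hψ => ?_
    rw [mem_closedBall_zero_iff, pi_norm_le_iff_of_nonneg zero_le_one]
    intro s
    have h1 := (isState_iff ψ).1 hψ
    have h2 : ‖ψ s‖ ^ 2 ≤ ∑ s, ‖ψ s‖ ^ 2 :=
      Finset.single_le_sum (f := fun s => ‖ψ s‖ ^ 2) (fun _ _ => by positivity) (Finset.mem_univ s)
    rw [h1] at h2
    nlinarith [norm_nonneg (ψ s)]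

end Scaling

section Blocks

variable {κ : Type*} [Fintype κ] [DecidableEq κ] {ι : κ → Type*} [∀ k, Fintype (ι k)]
  [∀ k, DecidableEq (ι k)]

/-- The product state of states of the blocks `ι k`. -/
noncomputable def tensor (ψ : ∀ k, (ι k → Bool) → ℂ) : ((Σ k, ι k) → Bool) → ℂ :=
  fun s => ∏ k, ψ k fun i => s ⟨k, i⟩

/-- The couplings inside the block `k`. -/
def blockJ (J : (Σ k, ι k) → (Σ k, ι k) → ℝ) (k : κ) : ι k → ι k → ℝ :=
  fun i j => J ⟨k, i⟩ ⟨k, j⟩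

/-- The couplings without those between different blocks. -/
def cutJ (J : (Σ k, ι k) → (Σ k, ι k) → ℝ) : (Σ k, ι k) → (Σ k, ι k) → ℝ :=
  fun x y => if x.1 = y.1 then J x y else 0

/-- The total strength of the couplings between different blocks. -/
def crossJ (J : (Σ k, ι k) → (Σ k, ι k) → ℝ) : ℝ :=
  ∑ x, ∑ y, if x.1 = y.1 then 0 else |J x y|

/-- The configuration `s` with the block `k` replaced by `t`. -/
def putBlock (k : κ) (t : ι k → Bool) (s : (Σ k, ι k) → Bool) : (Σ k, ι k) → Bool :=
  fun x => Function.update (fun l i => s ⟨l, i⟩) k t x.1 x.2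

theorem putBlock_same (k : κ) (t : ι k → Bool) (s) (i : ι k) : putBlock k t s ⟨k, i⟩ = t i := by
  simp [putBlock]

theorem putBlock_ne {k l : κ} (h : l ≠ k) (t : ι k → Bool) (s) (i : ι l) :
    putBlock k t s ⟨l, i⟩ = s ⟨l, i⟩ := by
  simp [putBlock, h]

theorem flip_putBlock (k : κ) (i : ι k) (t : ι k → Bool) (s) :
    flip ⟨k, i⟩ (putBlock k t s) = putBlock k (flip i t) s := by
  ext ⟨l, j⟩
  by_cases h : l = k
  · subst h
    by_cases hj : j = i
    · subst hj; simp [flip, putBlock_same]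
    · simp [flip, putBlock_same, hj]
  · rw [putBlock_ne h, flip, Function.update_of_ne, putBlock_ne h]
    rintro ⟨⟩; exact h rfl

theorem putBlock_putBlock (k : κ) (t : ι k → Bool) (s : (Σ k, ι k) → Bool) :
    putBlock k (fun i => s ⟨k, i⟩) (putBlock k t s) = s := by
  ext ⟨l, j⟩
  by_cases h : l = k
  · subst h; rw [putBlock_same]
  · rw [putBlock_ne h, putBlock_ne h]

/-- Exchange of the configuration of the block `k` with a given one. -/
def swapBlock (k : κ) : Equiv.Perm (((Σ k, ι k) → Bool) × (ι k → Bool)) :=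
  Function.Involutive.toPerm (fun p => (putBlock k p.2 p.1, fun i => p.1 ⟨k, i⟩)) fun p =>
    Prod.ext (putBlock_putBlock k p.2 p.1) (funext fun i => putBlock_same k p.2 p.1 i)

theorem sum_putBlock (k : κ) (G : ((Σ k, ι k) → Bool) → ℂ) :
    ∑ s, ∑ t, G (putBlock k t s) = Fintype.card (ι k → Bool) * ∑ s, G s := by
  have h := Equiv.sum_comp (swapBlock (ι := ι) k) fun p => G p.1
  rw [Fintype.sum_prod_type, Fintype.sum_prod_type] at h
  refine Eq.trans ?_ (h.trans ?_)
  · rfl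
  · rw [Finset.mul_sum]
    refine Finset.sum_congr rfl fun s _ => ?_
    simp

theorem sum_putBlock_real (k : κ) (G : ((Σ k, ι k) → Bool) → ℝ) :
    ∑ s, ∑ t, G (putBlock k t s) = Fintype.card (ι k → Bool) * ∑ s, G s := by
  exact_mod_cast sum_putBlock k fun s => (G s : ℂ)

/-- The part of a vector on the whole system that belongs to a configuration outside a block. -/
def slice (k : κ) (s : (Σ k, ι k) → Bool) (Ψ : ((Σ k, ι k) → Bool) → ℂ) : (ι k → Bool) → ℂ :=
  fun t => Ψ (putBlock k t s)

theorem sum_corrZ_slice (k : κ) (i j : ι k) (Ψ : ((Σ k, ι k) → Bool) → ℂ) :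
    ∑ s, corrZ i j (slice k s Ψ) = Fintype.card (ι k → Bool) * corrZ ⟨k, i⟩ ⟨k, j⟩ Ψ := by
  simp only [corrZ]
  rw [← sum_putBlock_real]
  simp only [putBlock_same, slice]

theorem sum_meanX_slice (k : κ) (i : ι k) (Ψ : ((Σ k, ι k) → Bool) → ℂ) :
    ∑ s, meanX i (slice k s Ψ) = Fintype.card (ι k → Bool) * meanX ⟨k, i⟩ Ψ := by
  simp only [meanX]
  rw [← sum_putBlock]
  simp only [slice, flip_putBlock]

theorem energyZ_cutJ (J : (Σ k, ι k) → (Σ k, ι k) → ℝ) (Ψ) :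
    energyZ (cutJ J) Ψ = ∑ k, -∑ i, ∑ j, blockJ J k i j * corrZ ⟨k, i⟩ ⟨k, j⟩ Ψ := by
  rw [energyZ, Finset.sum_neg_distrib, Fintype.sum_sigma]
  congr 1
  refine Finset.sum_congr rfl fun k _ => Finset.sum_congr rfl fun i _ => ?_
  rw [Fintype.sum_sigma, Finset.sum_eq_single k]
  · simp [cutJ, blockJ]
  · intro l _ hl
    refine Finset.sum_eq_zero fun j _ => ?_
    simp [cutJ, hl.symm]
  · simp

theorem magX_sigma (Ψ : ((Σ k, ι k) → Bool) → ℂ) :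
    magX Ψ = ∑ k, ∑ i : ι k, (meanX ⟨k, i⟩ Ψ).re := by
  rw [magX, Fintype.sum_sigma]

theorem sum_abs_sub_cutJ (J : (Σ k, ι k) → (Σ k, ι k) → ℝ) :
    ∑ x, ∑ y, |J x y - cutJ J x y| = crossJ J := by
  refine Finset.sum_congr rfl fun x _ => Finset.sum_congr rfl fun y _ => ?_
  by_cases h : x.1 = y.1 <;> simp [cutJ, h]

/-- The energy of a system is at least the sum of the energies of its blocks, up to the couplings
between the blocks. -/
theorem sum_gsE_le (J : (Σ k, ι k) → (Σ k, ι k) → ℝ) (γ : ℝ) :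
    ∑ k, gsE (blockJ J k) γ ≤ gsE J γ + crossJ J := by
  have h1 := gsE_sub_le (cutJ J) J γ
  simp only [abs_sub_comm (cutJ J _ _), sum_abs_sub_cutJ] at h1
  refine le_trans (le_gsE fun Ψ hΨ => ?_) h1
  rw [energyZ_cutJ, magX_sigma, Finset.mul_sum, ← Finset.sum_sub_distrib]
  refine Finset.sum_le_sum fun k _ => ?_
  have hc : (0 : ℝ) < Fintype.card (ι k → Bool) := by exact_mod_cast Fintype.card_pos
  refine le_of_mul_le_mul_left ?_ hc
  calc (Fintype.card (ι k → Bool) : ℝ) * gsE (blockJ J k) γ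
      = ∑ s, gsE (blockJ J k) γ * ∑ t, ‖slice k s Ψ t‖ ^ 2 := by
        rw [← Finset.mul_sum]
        simp only [slice]
        rw [sum_putBlock_real k fun s => ‖Ψ s‖ ^ 2, (isState_iff Ψ).1 hΨ]
        ring
    _ ≤ ∑ s, (energyZ (blockJ J k) (slice k s Ψ) - γ * magX (slice k s Ψ)) :=
        Finset.sum_le_sum fun s _ => gsE_mul_le _ _ _
    _ = _ := by
        have hm (i : ι k) : ∑ s, (meanX i (slice k s Ψ)).re =
            Fintype.card (ι k → Bool) * (meanX ⟨k, i⟩ Ψ).re := by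
          rw [← Complex.re_sum, sum_meanX_slice, ← Complex.ofReal_natCast, Complex.re_ofReal_mul]
        have hM : ∑ s, magX (slice k s Ψ) =
            Fintype.card (ι k → Bool) * ∑ i : ι k, (meanX ⟨k, i⟩ Ψ).re := by
          simp only [magX]
          rw [Finset.sum_comm, Finset.mul_sum]
          exact Finset.sum_congr rfl fun i _ => hm i
        have hZ : ∑ s, energyZ (blockJ J k) (slice k s Ψ) = Fintype.card (ι k → Bool) *
            -∑ i, ∑ j, blockJ J k i j * corrZ ⟨k, i⟩ ⟨k, j⟩ Ψ := by
          simp only [energyZ]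
          rw [Finset.sum_neg_distrib, Finset.sum_comm, mul_neg, Finset.mul_sum]
          congr 1
          refine Finset.sum_congr rfl fun i _ => ?_
          rw [Finset.sum_comm, Finset.mul_sum]
          refine Finset.sum_congr rfl fun j _ => ?_
          rw [← Finset.mul_sum, sum_corrZ_slice]
          ring
        rw [Finset.sum_sub_distrib, ← Finset.mul_sum, hM, hZ]
        ring

theorem sum_prod_blocks {R : Type*} [CommSemiring R] (f : ∀ k, (ι k → Bool) → R) :
    ∑ s : (Σ k, ι k) → Bool, ∏ k, f k (fun i => s ⟨k, i⟩) = ∏ k, ∑ t, f k t := by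
  rw [Finset.prod_univ_sum, Fintype.piFinset_univ]
  exact Equiv.sum_comp (Equiv.piCurry fun (k : κ) (_ : ι k) => Bool)
    fun p : ∀ k, ι k → Bool => ∏ k, f k (p k)

theorem sum_prod_update {R : Type*} [CommSemiring R] (f : ∀ k, (ι k → Bool) → R)
    (hf : ∀ k, ∑ t, f k t = 1) (k : κ) (g : (ι k → Bool) → R) :
    ∑ s : (Σ k, ι k) → Bool, ∏ l, Function.update f k g l (fun i => s ⟨l, i⟩) = ∑ t, g t := by
  rw [sum_prod_blocks, Fintype.prod_eq_single k]
  · simp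
  · intro l hl; simp [hl, hf]

theorem sum_prod_update_update {R : Type*} [CommSemiring R] (f : ∀ k, (ι k → Bool) → R)
    (hf : ∀ k, ∑ t, f k t = 1) {k l : κ} (hkl : k ≠ l) (g : (ι k → Bool) → R)
    (h : (ι l → Bool) → R) :
    ∑ s : (Σ k, ι k) → Bool,
      ∏ m, Function.update (Function.update f k g) l h m (fun i => s ⟨m, i⟩) =
      (∑ t, g t) * ∑ t, h t := by
  rw [sum_prod_blocks, Fintype.prod_eq_mul k l hkl]
  · simp [hkl]
  · rintro m ⟨hk, hl⟩; simp [hk, hl, hf]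

theorem flip_block_same (k : κ) (i : ι k) (s : (Σ k, ι k) → Bool) :
    (fun j => flip ⟨k, i⟩ s ⟨k, j⟩) = flip i fun j => s ⟨k, j⟩ := by
  ext j; by_cases hj : j = i
  · subst hj; simp [flip]
  · simp [flip, hj]

theorem flip_block_ne {k l : κ} (h : l ≠ k) (i : ι k) (s : (Σ k, ι k) → Bool) :
    (fun j => flip ⟨k, i⟩ s ⟨l, j⟩) = fun j => s ⟨l, j⟩ := by
  ext j
  rw [flip, Function.update_of_ne]
  rintro ⟨⟩; exact h rfl

variable {ψ : ∀ k, (ι k → Bool) → ℂ}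

theorem norm_sq_tensor (s) : ‖tensor ψ s‖ ^ 2 = ∏ k, ‖ψ k fun i => s ⟨k, i⟩‖ ^ 2 := by
  rw [tensor, norm_prod, Finset.prod_pow]

theorem isState_tensor (hψ : ∀ k, IsState (ψ k)) : IsState (tensor ψ) := by
  rw [isState_iff]
  simp only [norm_sq_tensor]
  rw [sum_prod_blocks fun k t => ‖ψ k t‖ ^ 2]
  exact Finset.prod_eq_one fun k _ => (isState_iff _).1 (hψ k)

theorem sum_star_mul_self {ι : Type*} [Fintype ι] [DecidableEq ι] {ψ : (ι → Bool) → ℂ}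
    (hψ : IsState ψ) : ∑ t, star (ψ t) * ψ t = 1 := hψ

theorem corrZ_tensor (hψ : ∀ k, IsState (ψ k)) (k : κ) (i j : ι k) :
    corrZ ⟨k, i⟩ ⟨k, j⟩ (tensor ψ) = corrZ i j (ψ k) := by
  rw [corrZ, corrZ, ← sum_prod_update (fun k t => ‖ψ k t‖ ^ 2) (fun k => (isState_iff _).1 (hψ k))]
  refine Finset.sum_congr rfl fun s _ => ?_
  rw [norm_sq_tensor, ← Finset.mul_prod_erase _ _ (Finset.mem_univ k),
    ← Finset.mul_prod_erase _ _ (Finset.mem_univ k), Function.update_self, mul_right_comm]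
  congr 1
  refine Finset.prod_congr rfl fun l hl => ?_
  rw [Function.update_of_ne (Finset.ne_of_mem_erase hl)]

theorem meanX_tensor (hψ : ∀ k, IsState (ψ k)) (k : κ) (i : ι k) :
    meanX ⟨k, i⟩ (tensor ψ) = meanX i (ψ k) := by
  rw [meanX, meanX, ← sum_prod_update (fun k t => star (ψ k t) * ψ k t)
    (fun k => sum_star_mul_self (hψ k))]
  refine Finset.sum_congr rfl fun s _ => ?_
  rw [tensor, tensor, star_prod, ← Finset.prod_mul_distrib]
  refine Finset.prod_congr rfl fun l _ => ?_
  by_cases h : l = k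
  · subst h; rw [Function.update_self, flip_block_same]
  · rw [Function.update_of_ne h, flip_block_ne h]

theorem corrX_tensor_of_ne (hψ : ∀ k, IsState (ψ k)) {k l : κ} (hkl : k ≠ l) (i : ι k) (j : ι l) :
    corrX ⟨k, i⟩ ⟨l, j⟩ (tensor ψ) = (meanX i (ψ k)).re * (meanX j (ψ l)).re := by
  have : ∑ s, star (tensor ψ s) * tensor ψ (flip ⟨l, j⟩ (flip ⟨k, i⟩ s)) =
      meanX i (ψ k) * meanX j (ψ l) := by
    rw [meanX, meanX, ← sum_prod_update_update (fun k t => star (ψ k t) * ψ k t)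
      (fun k => sum_star_mul_self (hψ k)) hkl]
    refine Finset.sum_congr rfl fun s _ => ?_
    rw [tensor, tensor, star_prod, ← Finset.prod_mul_distrib]
    refine Finset.prod_congr rfl fun m _ => ?_
    by_cases h : m = l
    · subst h; rw [Function.update_self, flip_block_same, flip_block_ne hkl.symm]
    · rw [Function.update_of_ne h, flip_block_ne h]
      by_cases h' : m = k
      · subst h'; rw [Function.update_self, flip_block_same]
      · rw [Function.update_of_ne h', flip_block_ne h']
  rw [corrX, this, meanX_eq_re i, meanX_eq_re j, ← Complex.ofReal_mul, Complex.ofReal_re,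
    Complex.ofReal_re, Complex.ofReal_re]

theorem energyZ_cutJ_tensor (hψ : ∀ k, IsState (ψ k)) (J : (Σ k, ι k) → (Σ k, ι k) → ℝ) :
    energyZ (cutJ J) (tensor ψ) = ∑ k, energyZ (blockJ J k) (ψ k) := by
  rw [energyZ_cutJ]
  simp only [corrZ_tensor hψ, energyZ]

theorem magX_tensor (hψ : ∀ k, IsState (ψ k)) : magX (tensor ψ) = ∑ k, magX (ψ k) := by
  rw [magX_sigma]
  simp only [meanX_tensor hψ, magX]

/-- In a product state the magnetizations of different blocks are uncorrelated. -/
theorem sum_corrX_tensor_le (hψ : ∀ k, IsState (ψ k)) :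
    ∑ x, ∑ y, corrX x y (tensor ψ) ≤
      (∑ k, magX (ψ k)) ^ 2 + 2 * ∑ k, (Fintype.card (ι k) : ℝ) ^ 2 := by
  have h1 : ∀ x y : Σ k, ι k, corrX x y (tensor ψ) ≤
      (meanX x (tensor ψ)).re * (meanX y (tensor ψ)).re + if x.1 = y.1 then 2 else 0 := by
    rintro ⟨k, i⟩ ⟨l, j⟩
    by_cases h : k = l
    · have h2 := (abs_le.1 (abs_corrX_le (isState_tensor hψ) ⟨k, i⟩ ⟨l, j⟩)).2
      have h3 := abs_meanX_le (isState_tensor hψ) ⟨k, i⟩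
      have h4 := abs_meanX_le (isState_tensor hψ) ⟨l, j⟩
      have h5 : |(meanX ⟨k, i⟩ (tensor ψ)).re * (meanX ⟨l, j⟩ (tensor ψ)).re| ≤ 1 := by
        rw [abs_mul]; exact mul_le_one₀ h3 (abs_nonneg _) h4
      have h6 := (abs_le.1 h5).1
      simp only [h, if_true]
      subst h
      linarith
    · simp [h, corrX_tensor_of_ne hψ h, meanX_tensor hψ]
  refine (Finset.sum_le_sum fun x _ => Finset.sum_le_sum fun y _ => h1 x y).trans (le_of_eq ?_)
  simp only [Finset.sum_add_distrib]
  congr 1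
  · rw [← magX_tensor hψ, magX, sq, Finset.sum_mul_sum]
  · rw [Fintype.sum_sigma, Finset.mul_sum]
    refine Finset.sum_congr rfl fun k _ => ?_
    have h3 (i : ι k) : ∑ y : Σ k, ι k, (if k = y.1 then (2 : ℝ) else 0) =
        Fintype.card (ι k) * 2 := by
      rw [Fintype.sum_sigma, Finset.sum_eq_single k]
      · simp
      · intro l _ hl; simp [hl.symm]
      · simp
    rw [Finset.sum_congr rfl fun i _ => h3 i]
    simp; ring

/-- The mean-field bound: product states of the blocks, with a self-consistent field. -/
theorem exists_groundEnergy_le (J : (Σ k, ι k) → (Σ k, ι k) → ℝ) (γ : ℝ) {α : ℝ} (hα : 0 ≤ α)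
    {N : ℝ} (hN : N = Fintype.card (Σ k, ι k)) (hN0 : 0 < N) :
    ∃ m : ℝ, |m| ≤ 1 ∧ groundEnergy (annealHam J γ α) ≤
      ∑ k, gsE (blockJ J k) (γ - 2 * α * m) - α * N * m ^ 2 + crossJ J +
        6 * α / N * ∑ k, (Fintype.card (ι k) : ℝ) ^ 2 := by
  let F : (∀ k, (ι k → Bool) → ℂ) → ℝ := fun ψ =>
    ∑ k, (energyZ (blockJ J k) (ψ k) - γ * magX (ψ k)) + α / N * (∑ k, magX (ψ k)) ^ 2
  have hF : Continuous F := by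
    have h1 (k) : Continuous fun ψ : ∀ k, (ι k → Bool) → ℂ => energyZ (blockJ J k) (ψ k) :=
      (continuous_energyZ _).comp (continuous_apply k)
    have h2 (k) : Continuous fun ψ : ∀ k, (ι k → Bool) → ℂ => magX (ψ k) :=
      continuous_magX.comp (continuous_apply k)
    fun_prop
  have hK : IsCompact (Set.univ.pi fun k => {ψ : (ι k → Bool) → ℂ | IsState ψ}) :=
    isCompact_univ_pi fun k => isCompact_isState
  have hne : (Set.univ.pi fun k => {ψ : (ι k → Bool) → ℂ | IsState ψ}).Nonempty :=
    Set.univ_pi_nonempty_iff.2 fun k =>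
      let ⟨ψ, h, _⟩ := exists_isState_magX_eq (ι := ι k) (ε := 1) (by norm_num)
      ⟨ψ, h⟩
  obtain ⟨ψ, hψK, hmin⟩ := hK.exists_isMinOn hne hF.continuousOn
  have hψ : ∀ k, IsState (ψ k) := fun k => hψK k (Set.mem_univ k)
  set M := ∑ k, magX (ψ k) with hM
  have hMN : |M| ≤ N := by
    rw [hM, ← magX_tensor hψ, hN]; exact abs_magX_le (isState_tensor hψ)
  set m := M / N with hm
  have hMm : M = m * N := by rw [hm, div_mul_cancel₀ _ hN0.ne']
  have hblock (k) : energyZ (blockJ J k) (ψ k) - (γ - 2 * α * m) * magX (ψ k) -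
      4 * α / N * (Fintype.card (ι k) : ℝ) ^ 2 ≤ gsE (blockJ J k) (γ - 2 * α * m) := by
    refine le_gsE fun φ hφ => ?_
    have hmem : Function.update ψ k φ ∈
        Set.univ.pi fun k => {ψ : (ι k → Bool) → ℂ | IsState ψ} := by
      intro l _
      by_cases h : l = k
      · subst h; simpa using hφ
      · simpa [h] using hψ l
    have h1 : F ψ ≤ F (Function.update ψ k φ) := hmin hmem
    have hsum (f : ∀ k, ((ι k → Bool) → ℂ) → ℝ) :
        ∑ l, f l (Function.update ψ k φ l) = ∑ l, f l (ψ l) + (f k φ - f k (ψ k)) := by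
      rw [← Finset.add_sum_erase _ _ (Finset.mem_univ k),
        ← Finset.add_sum_erase _ (fun l => f l (ψ l)) (Finset.mem_univ k), Function.update_self,
        Finset.sum_congr rfl fun l hl => by rw [Function.update_of_ne (Finset.ne_of_mem_erase hl)]]
      ring
    simp only [F] at h1
    rw [hsum fun k ψ => energyZ (blockJ J k) ψ - γ * magX ψ, hsum fun k ψ => magX ψ, ← hM] at h1
    set d := magX φ - magX (ψ k) with hd
    have hd2 : d ^ 2 ≤ 4 * (Fintype.card (ι k) : ℝ) ^ 2 := by
      have h3 := abs_le.1 (abs_magX_le hφ)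
      have h4 := abs_le.1 (abs_magX_le (hψ k))
      have h5 : |d| ≤ 2 * Fintype.card (ι k) := by rw [abs_le]; constructor <;> linarith
      nlinarith [abs_nonneg d, sq_abs d]
    have h6 : α / N * (M + d) ^ 2 = α / N * M ^ 2 + 2 * α * m * d + α / N * d ^ 2 := by
      rw [hm]; field_simp; ring
    have h7 : α / N * d ^ 2 ≤ 4 * α / N * (Fintype.card (ι k) : ℝ) ^ 2 := by
      calc α / N * d ^ 2 ≤ α / N * (4 * (Fintype.card (ι k) : ℝ) ^ 2) :=
            mul_le_mul_of_nonneg_left hd2 (div_nonneg hα hN0.le)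
        _ = _ := by ring
    rw [h6] at h1
    have h8 : 2 * α * m * d = 2 * α * m * magX φ - 2 * α * m * magX (ψ k) := by rw [hd]; ring
    linarith
  refine ⟨m, ?_, ?_⟩
  · rw [hm, abs_div, abs_of_pos hN0, div_le_one hN0]; exact hMN
  have h1 := Finset.sum_le_sum fun k (_ : k ∈ Finset.univ) => hblock k
  rw [Finset.sum_sub_distrib, Finset.sum_sub_distrib, ← Finset.mul_sum, ← Finset.mul_sum,
    ← hM] at h1
  have h2 := groundEnergy_le (annealHam J γ α) (isState_tensor hψ)
  rw [expect_annealHam, ← hN, magX_tensor hψ, ← hM] at h2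
  have h3 := (abs_le.1 (abs_energyZ_sub_le (isState_tensor hψ) J (cutJ J))).2
  rw [sum_abs_sub_cutJ, energyZ_cutJ_tensor hψ] at h3
  have h4 : α / N * ∑ x, ∑ y, corrX x y (tensor ψ) ≤
      α / N * (M ^ 2 + 2 * ∑ k, (Fintype.card (ι k) : ℝ) ^ 2) :=
    mul_le_mul_of_nonneg_left (sum_corrX_tensor_le hψ) (div_nonneg hα hN0.le)
  have h5 : α / N * (M ^ 2 + 2 * ∑ k, (Fintype.card (ι k) : ℝ) ^ 2) = α * N * m ^ 2 +
      2 * α / N * ∑ k, (Fintype.card (ι k) : ℝ) ^ 2 := by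
    rw [hMm]; field_simp
  have h6 : 6 * α / N * ∑ k, (Fintype.card (ι k) : ℝ) ^ 2 =
      2 * α / N * ∑ k, (Fintype.card (ι k) : ℝ) ^ 2 +
      4 * α / N * ∑ k, (Fintype.card (ι k) : ℝ) ^ 2 := by ring
  have h7 : (γ - 2 * α * m) * M = γ * M - 2 * (α * N * m ^ 2) := by rw [hMm]; ring
  linarith

theorem abs_gsE_sub_sum_le (J : (Σ k, ι k) → (Σ k, ι k) → ℝ) (γ : ℝ)
    (h0 : 0 < Fintype.card (Σ k, ι k)) :
    |gsE J γ - ∑ k, gsE (blockJ J k) γ| ≤ crossJ J := by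
  obtain ⟨m, -, h⟩ := exists_groundEnergy_le J γ le_rfl rfl (by exact_mod_cast h0)
  have h2 := sum_gsE_le J γ
  simp only [mul_zero, zero_mul, sub_zero, zero_div, add_zero] at h
  rw [abs_le]
  constructor
  · linarith
  · unfold gsE at *; linarith

end Blocks

section Prox

/-- `m` is minus the slope of a supergradient of `e` at `γ - 2 α m`. -/
def IsSelfConsistent (e : ℝ → ℝ) (α γ m : ℝ) : Prop :=
  ∀ x, e x + m * x ≤ e (γ - 2 * α * m) + m * (γ - 2 * α * m)

variable {e : ℝ → ℝ} {c α : ℝ}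

theorem exists_isSelfConsistent (hconc : ConcaveOn ℝ Set.univ e) (hcont : Continuous e)
    (hb : ∀ x, e x ≤ c) (hα : 0 < α) (γ : ℝ) : ∃ m, IsSelfConsistent e α γ m := by
  let f : ℝ → ℝ := fun x => e x - (γ - x) ^ 2 / (4 * α)
  have hf : Continuous f := by fun_prop
  have hlim : Tendsto f (cocompact ℝ) atBot := by
    have h1 : Tendsto (fun x => ‖x - γ‖) (cocompact ℝ) atTop := by
      refine tendsto_norm_cocompact_atTop.comp ?_
      exact (Homeomorph.subRight γ).isClosedEmbedding.tendsto_cocompact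
    have h2 : Tendsto (fun x => c - ‖x - γ‖ ^ 2 / (4 * α)) (cocompact ℝ) atBot := by
      refine tendsto_atBot_add_const_left _ c ?_
      exact tendsto_neg_atTop_atBot.comp
        (((tendsto_pow_atTop two_ne_zero).comp h1).atTop_div_const (by positivity))
    refine tendsto_atBot_mono (fun x => ?_) h2
    simp only [f, Real.norm_eq_abs, sq_abs]
    have : (γ - x) ^ 2 = (x - γ) ^ 2 := by ring
    rw [this]
    linarith [hb x]
  obtain ⟨y, hy⟩ := hf.exists_forall_ge hlim
  refine ⟨(γ - y) / (2 * α), ?_⟩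
  have hy0 : γ - 2 * α * ((γ - y) / (2 * α)) = y := by field_simp; ring
  intro x
  rw [hy0]
  set m := (γ - y) / (2 * α) with hm
  have hgy : γ - y = 2 * α * m := by rw [hm]; field_simp
  have key : ∀ t ∈ Set.Ioc (0 : ℝ) 1, e x - e y + m * (x - y) ≤ t * ((x - y) ^ 2 / (4 * α)) := by
    intro t ht
    have h1 := hconc.2 (Set.mem_univ x) (Set.mem_univ y) ht.1.le (sub_nonneg.2 ht.2)
      (add_sub_cancel t 1)
    have h2 := hy (t * x + (1 - t) * y)
    simp only [f, smul_eq_mul] at h1 h2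
    have h3 : (γ - (t * x + (1 - t) * y)) ^ 2 / (4 * α) =
        (γ - y) ^ 2 / (4 * α) - t * (m * (x - y)) + t * (t * ((x - y) ^ 2 / (4 * α))) := by
      have : γ - (t * x + (1 - t) * y) = 2 * α * m - t * (x - y) := by rw [← hgy]; ring
      rw [this, hgy]
      field_simp
      ring
    rw [h3] at h2
    refine le_of_mul_le_mul_left ?_ ht.1
    nlinarith
  have hlim2 : Tendsto (fun t : ℝ => t * ((x - y) ^ 2 / (4 * α))) (𝓝[>] 0) (𝓝 0) := by
    have : Continuous fun t : ℝ => t * ((x - y) ^ 2 / (4 * α)) := by fun_prop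
    simpa using (this.tendsto 0).mono_left nhdsWithin_le_nhds
  have := ge_of_tendsto hlim2 (by
    filter_upwards [Ioc_mem_nhdsGT (zero_lt_one' ℝ)] with t ht using key t ht)
  linarith

theorem IsSelfConsistent.mem_Icc (hb : ∀ x, |e x + (|x|)| ≤ c) {γ m : ℝ}
    (h : IsSelfConsistent e α γ m) : m ∈ Set.Icc (-1 : ℝ) 1 := by
  set C := e (γ - 2 * α * m) + m * (γ - 2 * α * m) with hC
  have h1 (x : ℝ) : m * x - |x| ≤ C + c := by
    have := h x
    have := (abs_le.1 (hb x)).1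
    linarith
  have hp : 0 ≤ C + c := by simpa using h1 0
  constructor
  · by_contra! hlt
    have h2 := h1 (-((C + c + 1) / (-1 - m)))
    rw [abs_neg, abs_of_nonneg (div_nonneg (by linarith) (by linarith))] at h2
    have h3 : m * -((C + c + 1) / (-1 - m)) - (C + c + 1) / (-1 - m) = C + c + 1 := by
      have : -1 - m ≠ 0 := by linarith
      field_simp
      ring
    linarith
  · by_contra! hlt
    have h2 := h1 ((C + c + 1) / (m - 1))
    rw [abs_of_nonneg (div_nonneg (by linarith) (by linarith))] at h2
    have h3 : m * ((C + c + 1) / (m - 1)) - (C + c + 1) / (m - 1) = C + c + 1 := by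
      have : m - 1 ≠ 0 := by linarith
      field_simp
    linarith

theorem continuous_of_isSelfConsistent (hα : 0 < α) {m : ℝ → ℝ}
    (h : ∀ γ, IsSelfConsistent e α γ (m γ)) : Continuous m := by
  have hL : LipschitzWith (Real.toNNReal (1 / (2 * α))) m := by
    refine LipschitzWith.of_dist_le_mul fun a b => ?_
    rw [Real.coe_toNNReal _ (by positivity), Real.dist_eq, Real.dist_eq]
    have h1 := h a (b - 2 * α * m b)
    have h2 := h b (a - 2 * α * m a)
    have h3 : 2 * α * (m a - m b) ^ 2 ≤ (m a - m b) * (a - b) := by nlinarith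
    have h4 : 2 * α * |m a - m b| ^ 2 ≤ |m a - m b| * |a - b| := by
      rw [sq_abs, ← abs_mul]; exact h3.trans (le_abs_self _)
    rcases (abs_nonneg (m a - m b)).eq_or_lt with h0 | h0
    · rw [← h0]; positivity
    · rw [one_div_mul_eq_div, le_div_iff₀ (by positivity)]
      refine le_of_mul_le_mul_left ?_ h0
      linarith
  exact hL.continuous

/-- The self-consistent magnetization is the unique minimizer of `u m + α m² - γ m`. -/
theorem IsSelfConsistent.lt (hα : 0 < α) {u : ℝ → ℝ}
    (hu : ∀ m ∈ Set.Icc (-1 : ℝ) 1, IsLUB (Set.range fun γ : ℝ => e γ + γ * m) (u m)) {γ m : ℝ}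
    (h : IsSelfConsistent e α γ m) (hm : m ∈ Set.Icc (-1 : ℝ) 1) {m' : ℝ}
    (hm' : m' ∈ Set.Icc (-1 : ℝ) 1) (hne : m' ≠ m) :
    u m + α * m ^ 2 - γ * m < u m' + α * m' ^ 2 - γ * m' := by
  set x := γ - 2 * α * m with hx
  have h1 : u m ≤ e x + x * m := (hu m hm).2 (by
    rintro _ ⟨y, rfl⟩
    have := h y
    dsimp only
    linarith)
  have h2 : e x + x * m' ≤ u m' := (hu m' hm').1 ⟨x, rfl⟩
  have h3 : 0 < α * (m' - m) ^ 2 := mul_pos hα (by positivity [sub_ne_zero.2 hne])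
  rw [hx] at h1 h2
  nlinarith

end Prox

section Deviation

variable {κ : Type*} [Fintype κ] [DecidableEq κ] {ι : κ → Type*} [∀ k, Fintype (ι k)]
  [∀ k, DecidableEq (ι k)] {S : Type*} [Fintype S] [DecidableEq S]

/-- In every ground state the magnetization density is close to the self-consistent one, if the
ground-state energies of the blocks of a decomposition add up to about `N e`. -/
theorem sq_sub_le_of_mem_groundStates (f : (Σ k, ι k) ≃ S) (J : S → S → ℝ) {e : ℝ → ℝ}
    {α γ m N Δ : ℝ} (hα : 0 < α) (hm1 : |m| ≤ 1) (hm : IsSelfConsistent e α γ m)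
    (hN : N = Fintype.card S) (hN0 : 0 < N)
    (hΔ : ∀ x, γ - 2 * α ≤ x → x ≤ γ + 2 * α →
      |∑ k, gsE (blockJ (fun a b => J (f a) (f b)) k) x - N * e x| ≤ N * Δ)
    {ψ} (hψ : ψ ∈ groundStates (annealHam J γ α)) :
    α * N * (expect (transMag S) ψ / N - m) ^ 2 ≤ 2 * (N * Δ) +
      2 * crossJ (fun a b => J (f a) (f b)) +
        6 * α / N * ∑ k, (Fintype.card (ι k) : ℝ) ^ 2 := by
  set J' : (Σ k, ι k) → (Σ k, ι k) → ℝ := fun a b => J (f a) (f b) with hJ'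
  have hN' : N = Fintype.card (Σ k, ι k) := by rw [hN, Fintype.card_congr f]
  obtain ⟨m', hm'1, hup⟩ := exists_groundEnergy_le J' γ hα.le hN' hN0
  rw [hJ', groundEnergy_reindex, ← hJ', ← expect_eq_groundEnergy hψ, expect_annealHam, ← hN] at hup
  have hrange {y : ℝ} (hy : |y| ≤ 1) :
      γ - 2 * α ≤ γ - 2 * α * y ∧ γ - 2 * α * y ≤ γ + 2 * α := by
    have := abs_le.1 hy
    constructor <;> nlinarith
  have h1 := (abs_le.1 (hΔ _ (hrange hm'1).1 (hrange hm'1).2)).2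
  have h2 := (abs_le.1 (hΔ _ (hrange hm1).1 (hrange hm1).2)).1
  have h3 := hm (γ - 2 * α * m')
  have h4 := sum_gsE_le J' (γ - 2 * α * m)
  rw [hJ', gsE_reindex f, ← hJ'] at h4
  have h5 := gsE_le (J := J) (γ := γ - 2 * α * m) hψ.1
  have h6 : α / N * magX ψ ^ 2 ≤ α / N * ∑ i, ∑ j, corrX i j ψ :=
    mul_le_mul_of_nonneg_left (sq_magX_le hψ.1) (by positivity)
  rw [expect_transMag]
  have h7 : α * N * (magX ψ / N - m) ^ 2 =
      α / N * magX ψ ^ 2 - 2 * α * m * magX ψ + α * N * m ^ 2 := by field_simp; ring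
  have h8 : N * (e (γ - 2 * α * m') + m * (γ - 2 * α * m')) ≤
      N * (e (γ - 2 * α * m) + m * (γ - 2 * α * m)) := mul_le_mul_of_nonneg_left h3 hN0.le
  have h9 : 0 ≤ α * N * (m - m') ^ 2 := by positivity
  nlinarith

end Deviation

section Measurability

variable {ι : Type*} [Fintype ι] [DecidableEq ι]

/-- The deviation with the field restricted to `[0, K]`. -/
noncomputable def deviationUpTo (J : ι → ι → ℝ) (α : ℝ) (m : ℝ → ℝ) (K : ℕ) : ℝ≥0∞ :=
  ⨆ (γ : ℝ) (_ : γ ∈ Set.Icc (0 : ℝ) K) (ψ ∈ groundStates (annealHam J γ α)),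
    ENNReal.ofReal |expect (transMag ι) ψ / (Fintype.card ι : ℝ) - m γ|

theorem deviation_eq_iSup (J : ι → ι → ℝ) (α : ℝ) (m : ℝ → ℝ) :
    deviation J α m = ⨆ K, deviationUpTo J α m K := by
  refine le_antisymm (iSup₂_le fun γ hγ => ?_) (iSup_le fun K => iSup₂_le fun γ hγ => ?_)
  · obtain ⟨K, hK⟩ := exists_nat_ge γ
    refine le_iSup_of_le K ?_
    exact le_iSup₂_of_le (f := fun γ (_ : γ ∈ Set.Icc (0 : ℝ) K) =>
      ⨆ ψ ∈ groundStates (annealHam J γ α),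
        ENNReal.ofReal |expect (transMag ι) ψ / (Fintype.card ι : ℝ) - m γ|) γ ⟨hγ, hK⟩ le_rfl
  · exact le_iSup₂_of_le (f := fun γ (_ : 0 ≤ γ) =>
      ⨆ ψ ∈ groundStates (annealHam J γ α),
        ENNReal.ofReal |expect (transMag ι) ψ / (Fintype.card ι : ℝ) - m γ|) γ hγ.1 le_rfl

theorem monotone_deviationUpTo (J : ι → ι → ℝ) (α : ℝ) (m : ℝ → ℝ) :
    Monotone (deviationUpTo J α m) := by
  intro K L hKL
  refine iSup₂_le fun γ hγ => ?_
  exact le_iSup₂_of_le (f := fun γ (_ : γ ∈ Set.Icc (0 : ℝ) L) =>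
      ⨆ ψ ∈ groundStates (annealHam J γ α),
        ENNReal.ofReal |expect (transMag ι) ψ / (Fintype.card ι : ℝ) - m γ|) γ
    ⟨hγ.1, hγ.2.trans (by exact_mod_cast hKL)⟩ le_rfl

theorem continuous_expect_annealHam (α : ℝ) :
    Continuous fun p : (ι → ι → ℝ) × ℝ × ((ι → Bool) → ℂ) =>
      expect (annealHam p.1 p.2.1 α) p.2.2 := by
  simp only [expect_annealHam, energyZ, magX, corrX, corrZ, meanX, RCLike.star_def]
  fun_prop

theorem isClosed_setOf_exists_groundState (α : ℝ) {m : ℝ → ℝ} (hm : Continuous m) (K : ℕ)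
    (t : ℝ) : IsClosed {J : ι → ι → ℝ | ∃ γ ∈ Set.Icc (0 : ℝ) K,
      ∃ ψ ∈ groundStates (annealHam J γ α),
        t ≤ |expect (transMag ι) ψ / (Fintype.card ι : ℝ) - m γ|} := by
  let Q : Set (ℝ × ((ι → Bool) → ℂ)) := Set.Icc (0 : ℝ) K ×ˢ {ψ | IsState ψ}
  have hQ : CompactSpace Q := isCompact_iff_compactSpace.1 (isCompact_Icc.prod isCompact_isState)
  let C : Set ((ι → ι → ℝ) × Q) :=
    (⋂ φ, ⋂ (_ : IsState φ), {p | expect (annealHam p.1 p.2.1.1 α) p.2.1.2 ≤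
      expect (annealHam p.1 p.2.1.1 α) φ}) ∩
    {p | t ≤ |expect (transMag ι) p.2.1.2 / (Fintype.card ι : ℝ) - m p.2.1.1|}
  have hmag : Continuous fun ψ : (ι → Bool) → ℂ => expect (transMag ι) ψ := by
    simpa only [expect_transMag] using continuous_magX
  have hC : IsClosed C := by
    refine IsClosed.inter ?_ ?_
    · refine isClosed_iInter fun φ => isClosed_iInter fun _ => ?_
      refine isClosed_le ?_ ?_
      · exact (continuous_expect_annealHam α).comp
          (f := fun p : (ι → ι → ℝ) × Q => (p.1, p.2.1.1, p.2.1.2)) (by fun_prop)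
      · exact (continuous_expect_annealHam α).comp
          (f := fun p : (ι → ι → ℝ) × Q => (p.1, p.2.1.1, φ)) (by fun_prop)
    · refine isClosed_le continuous_const ?_
      have h1 : Continuous fun p : (ι → ι → ℝ) × Q => expect (transMag ι) p.2.1.2 :=
        hmag.comp (by fun_prop)
      have h2 : Continuous fun p : (ι → ι → ℝ) × Q => m p.2.1.1 := hm.comp (by fun_prop)
      exact ((h1.div_const _).sub h2).abs
  convert isClosedMap_fst_of_compactSpace C hC using 1
  ext J
  simp only [C, Q, Set.mem_ofPred_eq, Set.mem_image, Prod.exists, Subtype.exists, groundStates,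
    Set.mem_inter_iff, Set.mem_iInter]
  constructor
  · rintro ⟨γ, hγ, ψ, ⟨hψ, hmin⟩, ht⟩
    exact ⟨J, γ, ψ, ⟨hγ, hψ⟩, ⟨hmin, ht⟩, rfl⟩
  · rintro ⟨J', γ, ψ, ⟨hγ, hψ⟩, ⟨hmin, ht⟩, rfl⟩
    exact ⟨γ, hγ, ψ, ⟨hψ, hmin⟩, ht⟩

theorem measurable_deviationUpTo (α : ℝ) {m : ℝ → ℝ} (hm : Continuous m) (K : ℕ) :
    Measurable fun J : ι → ι → ℝ => deviationUpTo J α m K := by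
  refine measurable_of_Ioi fun c => ?_
  have : (fun J : ι → ι → ℝ => deviationUpTo J α m K) ⁻¹' Set.Ioi c =
      ⋃ (t : ℚ) (_ : c < ENNReal.ofReal t), {J : ι → ι → ℝ | ∃ γ ∈ Set.Icc (0 : ℝ) K,
      ∃ ψ ∈ groundStates (annealHam J γ α),
        (t : ℝ) ≤ |expect (transMag ι) ψ / (Fintype.card ι : ℝ) - m γ|} := by
    ext J
    simp only [Set.mem_preimage, Set.mem_Ioi, deviationUpTo, lt_iSup_iff, Set.mem_iUnion,
      Set.mem_ofPred_eq, exists_prop]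
    constructor
    · rintro ⟨γ, hγ, ψ, hψ, h⟩
      have hc : c ≠ ∞ := h.ne_top
      rw [← ENNReal.ofReal_toReal hc, ENNReal.ofReal_lt_ofReal_iff_of_nonneg
        ENNReal.toReal_nonneg] at h
      obtain ⟨t, ht1, ht2⟩ := exists_rat_btwn h
      refine ⟨t, ?_, γ, hγ, ψ, hψ, ht2.le⟩
      rw [← ENNReal.ofReal_toReal hc]
      exact (ENNReal.ofReal_lt_ofReal_iff_of_nonneg ENNReal.toReal_nonneg).2 ht1
    · rintro ⟨t, ht, γ, hγ, ψ, hψ, h⟩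
      exact ⟨γ, hγ, ψ, hψ, ht.trans_le (ENNReal.ofReal_le_ofReal h)⟩
  rw [this]
  exact MeasurableSet.iUnion fun t => MeasurableSet.iUnion fun _ =>
    (isClosed_setOf_exists_groundState α hm K t).measurableSet

end Measurability

section Decomposition

variable {σ : Type*} [DecidableEq σ]

/-- The couplings of a finite region. -/
def regionJ (J : σ → σ → ℝ) (R : Finset σ) : R → R → ℝ := fun i j => J i j

/-- The sites of a region that is the disjoint union of the regions `S k`. -/
noncomputable def sigmaEquiv {κ : Type*} {S : κ → Finset σ} {R : Finset σ}
    (hdisj : ∀ k l, k ≠ l → Disjoint (S k) (S l)) (hR : ∀ x, x ∈ R ↔ ∃ k, x ∈ S k) :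
    (Σ k, S k) ≃ R :=
  Equiv.ofBijective (fun x => ⟨x.2.1, (hR _).2 ⟨x.1, x.2.2⟩⟩) (by
    constructor
    · rintro ⟨k, x, hx⟩ ⟨l, y, hy⟩ h
      have hxy : x = y := congrArg Subtype.val h
      subst hxy
      have hkl : k = l := by
        by_contra hne
        exact Finset.disjoint_left.1 (hdisj k l hne) hx hy
      subst hkl
      rfl
    · rintro ⟨x, hx⟩
      obtain ⟨k, hk⟩ := (hR x).1 hx
      exact ⟨⟨k, x, hk⟩, rfl⟩)

theorem sum_sigma_ite {κ : Type*} [Fintype κ] [DecidableEq κ] {S : κ → Finset σ} {R : Finset σ}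
    (hdisj : ∀ k l, k ≠ l → Disjoint (S k) (S l)) (hR : ∀ x, x ∈ R ↔ ∃ k, x ∈ S k)
    (w : σ → σ → ℝ) :
    ∑ x : Σ k, S k, ∑ y : Σ k, S k, (if x.1 = y.1 then 0 else w x.2 y.2) =
      ∑ k, ∑ i ∈ S k, ∑ j ∈ R \ S k, w i j := by
  rw [Fintype.sum_sigma]
  refine Finset.sum_congr rfl fun k _ => ?_
  rw [← Finset.sum_coe_sort (S k)]
  refine Finset.sum_congr rfl fun i _ => ?_
  have h1 (y : Σ k, S k) : (if k = y.1 then 0 else w i y.2) =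
      (fun j : R => if (j : σ) ∈ S k then 0 else w i j) (sigmaEquiv hdisj hR y) := by
    have h2 : (sigmaEquiv hdisj hR y : σ) = y.2 := rfl
    have h3 : k = y.1 ↔ (y.2 : σ) ∈ S k := by
      constructor
      · rintro rfl; exact y.2.2
      · intro h
        by_contra hne
        exact Finset.disjoint_left.1 (hdisj k y.1 hne) h y.2.2
    simp only [h2, h3]
  rw [Finset.sum_congr rfl fun y _ => h1 y, Equiv.sum_comp (sigmaEquiv hdisj hR)
    (fun j : R => if (j : σ) ∈ S k then 0 else w i j),
    Finset.sum_coe_sort R fun j => if j ∈ S k then 0 else w i j, Finset.sdiff_eq_filter,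
    Finset.sum_filter]
  refine Finset.sum_congr rfl fun j _ => ?_
  by_cases h : j ∈ S k <;> simp [h]

variable {ν : Type*} [DecidableEq ν]

/-- The strength of the couplings that a decomposition of `R` into blocks `T v`, `v ∈ V`, and
single sites neglects. -/
def neglectedJ (J : σ → σ → ℝ) (R : Finset σ) (V : Finset ν) (T : ν → Finset σ) : ℝ :=
  ∑ v ∈ V, ∑ i ∈ T v, ∑ j ∈ R \ T v, |J i j| + ∑ i ∈ R \ V.biUnion T, ∑ j ∈ R, |J i j|

/-- The regions of a decomposition into the blocks `T v`, `v ∈ V`, and single sites. -/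
def pieces (R : Finset σ) (V : Finset ν) (T : ν → Finset σ) :
    V ⊕ ↥(R \ V.biUnion T) → Finset σ :=
  Sum.elim (fun v => T v) (fun r => {(r : σ)})

variable {R : Finset σ} {V : Finset ν} {T : ν → Finset σ}

theorem disjoint_pieces (hdisj : ∀ v ∈ V, ∀ w ∈ V, v ≠ w → Disjoint (T v) (T w)) :
    ∀ k l, k ≠ l → Disjoint (pieces R V T k) (pieces R V T l) := by
  have h1 (v : V) (r : ↥(R \ V.biUnion T)) : (r : σ) ∉ T v := fun h =>
    (Finset.mem_sdiff.1 r.2).2 (Finset.mem_biUnion.2 ⟨v, v.2, h⟩)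
  rintro (v | r) (w | r') h
  · exact hdisj v v.2 w w.2 fun h' => h (congrArg Sum.inl (Subtype.ext h'))
  · simpa [pieces] using h1 v r'
  · simpa [pieces] using h1 w r
  · have : (r : σ) ≠ r' := fun h' => h (congrArg Sum.inr (Subtype.ext h'))
    simpa [pieces] using this

theorem mem_iff_exists_pieces (hsub : ∀ v ∈ V, T v ⊆ R) (x : σ) :
    x ∈ R ↔ ∃ k, x ∈ pieces R V T k := by
  constructor
  · intro hx
    by_cases h : x ∈ V.biUnion T
    · obtain ⟨v, hv, hxv⟩ := Finset.mem_biUnion.1 h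
      exact ⟨Sum.inl ⟨v, hv⟩, hxv⟩
    · exact ⟨Sum.inr ⟨x, Finset.mem_sdiff.2 ⟨hx, h⟩⟩, by simp [pieces]⟩
  · rintro ⟨v | r, h⟩
    · exact hsub v v.2 h
    · have : x = r := by simpa [pieces] using h
      rw [this]; exact (Finset.mem_sdiff.1 r.2).1

section

variable (hsub : ∀ v ∈ V, T v ⊆ R) (hdisj : ∀ v ∈ V, ∀ w ∈ V, v ≠ w → Disjoint (T v) (T w))

theorem crossJ_add_eq (J : σ → σ → ℝ) :
    crossJ (fun a b => regionJ J R
      (sigmaEquiv (disjoint_pieces (R := R) hdisj) (mem_iff_exists_pieces hsub) a)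
      (sigmaEquiv (disjoint_pieces (R := R) hdisj) (mem_iff_exists_pieces hsub) b)) +
      ∑ r ∈ R \ V.biUnion T, |J r r| = neglectedJ J R V T := by
  have h1 := sum_sigma_ite (disjoint_pieces (R := R) hdisj) (mem_iff_exists_pieces hsub)
    fun i j => |J i j|
  rw [Fintype.sum_sum_type] at h1
  refine (congrArg (· + _) h1).trans ?_
  simp only [pieces, Sum.elim_inl, Sum.elim_inr, Finset.sum_singleton]
  rw [Finset.sum_coe_sort V fun v => ∑ i ∈ T v, ∑ j ∈ R \ T v, |J i j|,
    Finset.sum_coe_sort (R \ V.biUnion T) fun r => ∑ j ∈ R \ {r}, |J r j|, neglectedJ, add_assoc,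
    ← Finset.sum_add_distrib]
  congr 1
  refine Finset.sum_congr rfl fun r hr => ?_
  rw [Finset.sdiff_singleton_eq_erase, Finset.sum_erase_add _ _ (Finset.mem_sdiff.1 hr).1]

theorem abs_sum_gsE_pieces_sub_le (J : σ → σ → ℝ) (x : ℝ) :
    |∑ k, gsE (blockJ (fun a b => regionJ J R
      (sigmaEquiv (disjoint_pieces (R := R) hdisj) (mem_iff_exists_pieces hsub) a)
      (sigmaEquiv (disjoint_pieces (R := R) hdisj) (mem_iff_exists_pieces hsub) b)) k) x -
      (∑ v ∈ V, gsE (regionJ J (T v)) x - |x| * (R \ V.biUnion T).card)| ≤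
      ∑ r ∈ R \ V.biUnion T, |J r r| := by
  have h1 : ∑ k, gsE (blockJ (fun a b => regionJ J R
      (sigmaEquiv (disjoint_pieces (R := R) hdisj) (mem_iff_exists_pieces hsub) a)
      (sigmaEquiv (disjoint_pieces (R := R) hdisj) (mem_iff_exists_pieces hsub) b)) k) x =
      ∑ v ∈ V, gsE (regionJ J (T v)) x + ∑ r ∈ R \ V.biUnion T, gsE (regionJ J {r}) x := by
    rw [Fintype.sum_sum_type, ← Finset.sum_coe_sort V,
      ← Finset.sum_coe_sort (R \ V.biUnion T) fun r => gsE (regionJ J {r}) x]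
    rfl
  have h2 : ∑ v ∈ V, gsE (regionJ J (T v)) x + ∑ r ∈ R \ V.biUnion T, gsE (regionJ J {r}) x -
      (∑ v ∈ V, gsE (regionJ J (T v)) x - |x| * (R \ V.biUnion T).card) =
      ∑ r ∈ R \ V.biUnion T, (gsE (regionJ J {r}) x + |x|) := by
    rw [Finset.sum_add_distrib, Finset.sum_const, nsmul_eq_mul]; ring
  rw [h1, h2]
  refine (Finset.abs_sum_le_sum_abs _ _).trans (Finset.sum_le_sum fun r _ => ?_)
  have h3 := abs_gsE_add_le (regionJ J {r}) x
  simpa [regionJ] using h3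

include hsub hdisj

/-- The energy of a region and the energies of the blocks of a decomposition. -/
theorem abs_gsE_sub_sum_blocks_le (hR : R.Nonempty) (J : σ → σ → ℝ) (x : ℝ) :
    |gsE (regionJ J R) x - (∑ v ∈ V, gsE (regionJ J (T v)) x - |x| * (R \ V.biUnion T).card)| ≤
      neglectedJ J R V T := by
  have h1 := abs_sum_gsE_pieces_sub_le hsub hdisj J x
  set f := sigmaEquiv (disjoint_pieces (R := R) hdisj) (mem_iff_exists_pieces hsub) with hf
  have h0 : 0 < Fintype.card (Σ k, pieces R V T k) := by
    rw [Fintype.card_congr f, Fintype.card_coe]; exact hR.card_pos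
  have h2 := abs_gsE_sub_sum_le (fun a b => regionJ J R (f a) (f b)) x h0
  rw [gsE_reindex f] at h2
  have h3 := crossJ_add_eq hsub hdisj J
  rw [← hf] at h3
  rw [← h3]
  exact (abs_sub_le _ _ _).trans (add_le_add h2 h1)

theorem sq_sub_le_of_mem_groundStates_region (J : σ → σ → ℝ) {e : ℝ → ℝ}
    {α γ m N Δ : ℝ} (hα : 0 < α) (hm1 : |m| ≤ 1) (hm : IsSelfConsistent e α γ m)
    (hN : N = R.card) (hN0 : 0 < N)
    (hΔ : ∀ x, γ - 2 * α ≤ x → x ≤ γ + 2 * α →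
      |∑ v ∈ V, gsE (regionJ J (T v)) x - |x| * (R \ V.biUnion T).card - N * e x| ≤ Δ)
    {ψ} (hψ : ψ ∈ groundStates (annealHam (regionJ J R) γ α)) :
    α * N * (expect (transMag R) ψ / (Fintype.card R : ℝ) - m) ^ 2 ≤
      2 * Δ + 2 * neglectedJ J R V T +
        6 * α / N * (∑ v ∈ V, ((T v).card : ℝ) ^ 2 + (R \ V.biUnion T).card) := by
  have hN' : N = Fintype.card R := by rw [hN, Fintype.card_coe]
  have h1 := sq_sub_le_of_mem_groundStates
    (sigmaEquiv (disjoint_pieces (R := R) hdisj) (mem_iff_exists_pieces hsub)) (regionJ J R)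
    (Δ := (Δ + ∑ r ∈ R \ V.biUnion T, |J r r|) / N) hα hm1 hm hN' hN0 (fun x hx1 hx2 => by
      rw [mul_div_cancel₀ _ hN0.ne']
      have h2 := abs_sum_gsE_pieces_sub_le hsub hdisj J x
      have h3 := (abs_sub_le _ _ _).trans (add_le_add h2 (hΔ x hx1 hx2))
      rwa [add_comm] at h3) hψ
  rw [mul_div_cancel₀ _ hN0.ne'] at h1
  have h4 : ∑ k, (Fintype.card (pieces R V T k) : ℝ) ^ 2 =
      ∑ v ∈ V, ((T v).card : ℝ) ^ 2 + (R \ V.biUnion T).card := by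
    simp only [Fintype.card_coe]
    rw [Fintype.sum_sum_type, ← Finset.sum_coe_sort V]
    simp [pieces]
  rw [h4] at h1
  rw [← hN', ← crossJ_add_eq hsub hdisj J]
  linarith

theorem card_eq_sum_add : R.card = ∑ v ∈ V, (T v).card + (R \ V.biUnion T).card := by
  rw [← Finset.card_biUnion fun v hv w hw h => hdisj v hv w hw h, add_comm,
    Finset.card_sdiff_add_card_eq_card (Finset.biUnion_subset.2 hsub)]

end

end Decomposition

section Rms

variable {Ω : Type*} [MeasurableSpace Ω] {μ : Measure Ω}

theorem rms_nonneg (X : Ω → ℝ) : 0 ≤ rms μ X := Real.sqrt_nonneg _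

theorem integral_abs_mul_abs_le {X Y : Ω → ℝ} (hX : MemLp X 2 μ) (hY : MemLp Y 2 μ) :
    ∫ ω, |X ω| * |Y ω| ∂μ ≤ rms μ X * rms μ Y := by
  have h := integral_mul_le_Lp_mul_Lq_of_nonneg (μ := μ) (f := fun ω => |X ω|)
    (g := fun ω => |Y ω|) Real.HolderConjugate.two_two (Eventually.of_forall fun _ => abs_nonneg _)
    (Eventually.of_forall fun _ => abs_nonneg _) (by rw [ENNReal.ofReal_ofNat]; exact hX.abs)
    (by rw [ENNReal.ofReal_ofNat]; exact hY.abs)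
  simpa [rms, Real.sqrt_eq_rpow] using h

variable [IsProbabilityMeasure μ]

theorem integral_abs_le_rms {X : Ω → ℝ} (hX : MemLp X 2 μ) : ∫ ω, |X ω| ∂μ ≤ rms μ X := by
  have h := integral_abs_mul_abs_le hX (memLp_const (1 : ℝ))
  simpa [rms] using h

theorem integral_sq_sum_abs_le {κ : Type*} (s : Finset κ) {X : κ → Ω → ℝ}
    (hX : ∀ k ∈ s, MemLp (X k) 2 μ) :
    ∫ ω, (∑ k ∈ s, |X k ω|) ^ 2 ∂μ ≤ (∑ k ∈ s, rms μ (X k)) ^ 2 := by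
  have hint (k) (hk : k ∈ s) (l) (hl : l ∈ s) : Integrable (fun ω => |X k ω| * |X l ω|) μ :=
    (hX k hk).abs.integrable_mul (hX l hl).abs
  simp only [sq, Finset.sum_mul_sum]
  rw [integral_finsetSum _ fun k hk => integrable_finsetSum _ fun l hl => hint k hk l hl]
  refine Finset.sum_le_sum fun k hk => ?_
  rw [integral_finsetSum _ fun l hl => hint k hk l hl]
  exact Finset.sum_le_sum fun l hl => integral_abs_mul_abs_le (hX k hk) (hX l hl)

end Rms

section Disorder

variable {D q : ℕ} {Ω : Type*} [MeasurableSpace Ω] {μ : Measure Ω}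
  {J : Site D q → Site D q → Ω → ℝ}

theorem shift_injective (v : Fin D → ℤ) : Function.Injective (shift (q := q) v) := by
  rintro ⟨a, s⟩ ⟨b, t⟩ h
  simpa [shift] using h

theorem iIndepFun_bonds (hJ : IsShiftInvariantDisorder μ J) {R : Type*} {g : R → Site D q}
    (hg : Function.Injective g) :
    iIndepFun (fun (b : Sym2 R) (ω : Ω) (p : {p : R × R // s(p.1, p.2) = b}) =>
      J (g p.1.1) (g p.1.2) ω) μ := by
  have h1 := hJ.indep.precomp (Sym2.map.injective hg)
  refine h1.comp (fun (b : Sym2 R)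
    (Z : {p : Site D q × Site D q // s(p.1, p.2) = Sym2.map g b} → ℝ)
    (p : {p : R × R // s(p.1, p.2) = b}) =>
      Z ⟨(g p.1.1, g p.1.2), congrArg (Sym2.map g) p.2⟩) ?_
  intro b
  fun_prop

theorem aemeasurable_bond (hJ : IsShiftInvariantDisorder μ J) {R : Type*} [Countable R]
    (g : R → Site D q) (b : Sym2 R) :
    AEMeasurable (fun (ω : Ω) (p : {p : R × R // s(p.1, p.2) = b}) =>
      J (g p.1.1) (g p.1.2) ω) μ :=
  aemeasurable_pi_lambda _ fun _ => (hJ.memLp _ _).aestronglyMeasurable.aemeasurable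

/-- Translation does not change the joint law of all the couplings of a region. -/
theorem identDistrib_shift (hJ : IsShiftInvariantDisorder μ J) (R : Finset (Site D q))
    (v : Fin D → ℤ) :
    IdentDistrib (fun ω => (fun i j : R => J (shift v i) (shift v j) ω))
      (fun ω => restrictCouplings J R ω) μ μ := by
  have hbond : ∀ b : Sym2 R, IdentDistrib
      (fun (ω : Ω) (p : {p : R × R // s(p.1, p.2) = b}) => J (shift v p.1.1) (shift v p.1.2) ω)
      (fun (ω : Ω) (p : {p : R × R // s(p.1, p.2) = b}) => J p.1.1 p.1.2 ω) μ μ := by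
    intro b
    induction b using Sym2.ind with | _ i j =>
    have hm (a b : Site D q) : AEMeasurable (fun ω => (J a b ω, J b a ω)) μ :=
      (hJ.memLp _ _).aestronglyMeasurable.aemeasurable.prodMk
        (hJ.memLp _ _).aestronglyMeasurable.aemeasurable
    have hpair : IdentDistrib
        (fun ω => (J (shift v i) (shift v j) ω, J (shift v j) (shift v i) ω))
        (fun ω => (J i j ω, J j i ω)) μ μ := ⟨hm _ _, hm _ _, hJ.shift_law v i j⟩
    have hΦ : Measurable fun (z : ℝ × ℝ) (p : {p : R × R // s(p.1, p.2) = s(i, j)}) =>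
        if p.1 = (i, j) then z.1 else z.2 := by
      refine measurable_pi_lambda _ fun p => ?_
      split_ifs
      · exact measurable_fst
      · exact measurable_snd
    have heq (f : R → Site D q) :
        (fun (z : ℝ × ℝ) (p : {p : R × R // s(p.1, p.2) = s(i, j)}) =>
          if p.1 = (i, j) then z.1 else z.2) ∘ (fun ω => (J (f i) (f j) ω, J (f j) (f i) ω)) =
        fun (ω : Ω) (p : {p : R × R // s(p.1, p.2) = s(i, j)}) => J (f p.1.1) (f p.1.2) ω := by
      ext ω ⟨⟨k, l⟩, hp⟩
      rcases Sym2.eq_iff.1 hp with ⟨rfl, rfl⟩ | ⟨rfl, rfl⟩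
      · simp
      · by_cases h : (k, l) = (l, k)
        · obtain ⟨h1, h2⟩ := Prod.mk.inj h
          subst h1
          simp
        · simp [h]
    have := hpair.comp hΦ
    rwa [heq fun a => shift v a, heq fun a => a] at this
  have h := IdentDistrib.pi hbond
    (iIndepFun_bonds hJ (R := R) (g := fun a => shift v a)
      ((shift_injective v).comp Subtype.val_injective))
    (iIndepFun_bonds hJ (R := R) (g := fun a => a) Subtype.val_injective)
  have hΨ : Measurable fun (Z : ∀ b : Sym2 R, {p : R × R // s(p.1, p.2) = b} → ℝ) (i j : R) =>
      Z s(i, j) ⟨(i, j), rfl⟩ := by fun_prop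
  exact h.comp hΨ

/-- The couplings of disjoint regions are independent. -/
theorem indepFun_restrictCouplings (hJ : IsShiftInvariantDisorder μ J) {A B : Finset (Site D q)}
    (hAB : Disjoint A B) :
    IndepFun (fun ω => restrictCouplings J A ω) (fun ω => restrictCouplings J B ω) μ := by
  classical
  let bonds (C : Finset (Site D q)) : Finset (Sym2 (Site D q)) :=
    (C ×ˢ C).image fun p => s(p.1, p.2)
  have hmem (C : Finset (Site D q)) (i j : C) : s((i : Site D q), (j : Site D q)) ∈ bonds C :=
    Finset.mem_image.2 ⟨(i, j), Finset.mem_product.2 ⟨i.2, j.2⟩, rfl⟩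
  have hdisj : Disjoint (bonds A) (bonds B) := by
    rw [Finset.disjoint_left]
    intro b hA hB
    obtain ⟨⟨i, j⟩, hij, rfl⟩ := Finset.mem_image.1 hA
    obtain ⟨⟨k, l⟩, hkl, h⟩ := Finset.mem_image.1 hB
    rw [Finset.mem_product] at hij hkl
    rcases Sym2.eq_iff.1 h with ⟨h1, h2⟩ | ⟨h1, h2⟩
    · exact Finset.disjoint_left.1 hAB hij.1 (h1 ▸ hkl.1)
    · exact Finset.disjoint_left.1 hAB hij.2 (h1 ▸ hkl.1)
  have h := hJ.indep.indepFun_finset₀ (bonds A) (bonds B) hdisj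
    (aemeasurable_bond hJ fun a => a)
  have hmeas (C : Finset (Site D q)) : Measurable
      fun (Z : ∀ b : bonds C, {p : Site D q × Site D q // s(p.1, p.2) = b} → ℝ) (i j : C) =>
        Z ⟨s((i : Site D q), (j : Site D q)), hmem C i j⟩ ⟨(i, j), rfl⟩ := by fun_prop
  exact h.comp (hmeas A) (hmeas B)

theorem aemeasurable_restrictCouplings (hJ : IsShiftInvariantDisorder μ J)
    (R : Finset (Site D q)) : AEMeasurable (fun ω => restrictCouplings J R ω) μ :=
  aemeasurable_pi_lambda _ fun _ => aemeasurable_pi_lambda _ fun _ =>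
    (hJ.memLp _ _).aestronglyMeasurable.aemeasurable

/-- The ground-state energy of `U - γ M` in a region. -/
noncomputable def energy (J : Site D q → Site D q → Ω → ℝ) (R : Finset (Site D q)) (γ : ℝ)
    (ω : Ω) : ℝ := gsE (restrictCouplings J R ω) γ

/-- A region and its translate have the same number of sites. -/
noncomputable def shiftEquiv (v : Fin D → ℤ) (R : Finset (Site D q)) :
    R ≃ translateRegion v R :=
  Equiv.ofBijective (fun i => ⟨shift v i, Finset.mem_image_of_mem _ i.2⟩) (by
    constructor
    · intro i j h
      exact Subtype.ext (shift_injective v (congrArg Subtype.val h))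
    · rintro ⟨x, hx⟩
      obtain ⟨y, hy, rfl⟩ := Finset.mem_image.1 hx
      exact ⟨⟨y, hy⟩, rfl⟩)

theorem card_translateRegion (v : Fin D → ℤ) (R : Finset (Site D q)) :
    (translateRegion v R).card = R.card :=
  Finset.card_image_of_injective _ (shift_injective v)

theorem identDistrib_energy_translateRegion (hJ : IsShiftInvariantDisorder μ J)
    (R : Finset (Site D q)) (v : Fin D → ℤ) (γ : ℝ) :
    IdentDistrib (energy J (translateRegion v R) γ) (energy J R γ) μ μ := by
  have h := (identDistrib_shift hJ R v).comp (continuous_gsE γ).measurable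
  have h1 : energy J (translateRegion v R) γ =
      (fun J' => gsE J' γ) ∘ fun ω => (fun i j : R => J (shift v i) (shift v j) ω) := by
    ext ω
    exact (gsE_reindex (shiftEquiv v R) (restrictCouplings J (translateRegion v R) ω) γ).symm
  rw [h1]
  exact h

/-- The total strength of the couplings in a region. -/
def totalJ (J : Site D q → Site D q → Ω → ℝ) (R : Finset (Site D q)) (ω : Ω) : ℝ :=
  ∑ i ∈ R, ∑ j ∈ R, |J i j ω|

theorem abs_energy_add_le (R : Finset (Site D q)) (γ : ℝ) (ω : Ω) :
    |energy J R γ ω + |γ| * R.card| ≤ totalJ J R ω := by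
  have h := abs_gsE_add_le (restrictCouplings J R ω) γ
  rw [Fintype.card_coe] at h
  refine h.trans (le_of_eq ?_)
  rw [totalJ, ← Finset.sum_coe_sort R]
  refine Finset.sum_congr rfl fun i _ => ?_
  rw [← Finset.sum_coe_sort R]
  rfl

theorem memLp_totalJ (hJ : IsShiftInvariantDisorder μ J) (R : Finset (Site D q)) :
    MemLp (totalJ J R) 2 μ :=
  memLp_finsetSum _ fun i _ => memLp_finsetSum _ fun j _ => (hJ.memLp i j).abs

theorem aestronglyMeasurable_energy (hJ : IsShiftInvariantDisorder μ J) (R : Finset (Site D q))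
    (γ : ℝ) : AEStronglyMeasurable (energy J R γ) μ :=
  ((continuous_gsE γ).measurable.comp_aemeasurable
    (aemeasurable_restrictCouplings hJ R)).aestronglyMeasurable

variable [IsProbabilityMeasure μ]

theorem memLp_energy_add (hJ : IsShiftInvariantDisorder μ J) (R : Finset (Site D q)) (γ : ℝ) :
    MemLp (fun ω => energy J R γ ω + |γ| * R.card) 2 μ :=
  (memLp_totalJ hJ R).mono ((aestronglyMeasurable_energy hJ R γ).add aestronglyMeasurable_const)
    (Eventually.of_forall fun ω => (abs_energy_add_le R γ ω).trans (le_abs_self _))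

theorem memLp_energy (hJ : IsShiftInvariantDisorder μ J) (R : Finset (Site D q)) (γ : ℝ) :
    MemLp (energy J R γ) 2 μ := by
  have := (memLp_energy_add hJ R γ).sub (memLp_const (|γ| * R.card))
  refine this.ae_eq (Eventually.of_forall fun ω => ?_)
  simp

theorem integrable_energy (hJ : IsShiftInvariantDisorder μ J) (R : Finset (Site D q)) (γ : ℝ) :
    Integrable (energy J R γ) μ := (memLp_energy hJ R γ).integrable one_le_two

theorem integral_totalJ_sq_le (hJ : IsShiftInvariantDisorder μ J) {R : Finset (Site D q)} {c : ℝ}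
    (hc : ∀ i ∈ R, ∑ j ∈ R, rms μ (J i j) ≤ c) :
    ∫ ω, totalJ J R ω ^ 2 ∂μ ≤ (c * R.card) ^ 2 := by
  have h1 := integral_sq_sum_abs_le (μ := μ) (R ×ˢ R) (X := fun p => J p.1 p.2)
    fun p _ => hJ.memLp _ _
  have h2 : ∑ p ∈ R ×ˢ R, rms μ (J p.1 p.2) ≤ c * R.card := by
    rw [Finset.sum_product]
    refine (Finset.sum_le_sum hc).trans ?_
    rw [Finset.sum_const, nsmul_eq_mul, mul_comm]
  simp only [Finset.sum_product] at h1 h2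
  refine h1.trans (pow_le_pow_left₀ ?_ h2 2)
  exact Finset.sum_nonneg fun _ _ => Finset.sum_nonneg fun _ _ => rms_nonneg _

theorem integral_totalJ_le (hJ : IsShiftInvariantDisorder μ J) {R : Finset (Site D q)} {c : ℝ}
    (hc : ∀ i ∈ R, ∑ j ∈ R, rms μ (J i j) ≤ c) :
    ∫ ω, totalJ J R ω ∂μ ≤ c * R.card := by
  have hint (i j) : Integrable (fun ω => |J i j ω|) μ :=
    ((hJ.memLp i j).integrable one_le_two).abs
  simp only [totalJ]
  rw [integral_finsetSum _ fun i _ => integrable_finsetSum _ fun j _ => hint i j]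
  rw [mul_comm, ← nsmul_eq_mul, ← Finset.sum_const]
  refine Finset.sum_le_sum fun i hi => ?_
  rw [integral_finsetSum _ fun j _ => hint i j]
  exact (Finset.sum_le_sum fun j _ => integral_abs_le_rms (hJ.memLp i j)).trans (hc i hi)

/-- The mean energy. -/
noncomputable def meanEnergy (μ : Measure Ω) (J : Site D q → Site D q → Ω → ℝ)
    (R : Finset (Site D q)) (γ : ℝ) : ℝ := ∫ ω, energy J R γ ω ∂μ

theorem abs_meanEnergy_add_le (hJ : IsShiftInvariantDisorder μ J) {R : Finset (Site D q)} {c : ℝ}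
    (hc : ∀ i ∈ R, ∑ j ∈ R, rms μ (J i j) ≤ c) (γ : ℝ) :
    |meanEnergy μ J R γ + |γ| * R.card| ≤ c * R.card := by
  have h1 : meanEnergy μ J R γ + |γ| * R.card = ∫ ω, (energy J R γ ω + |γ| * R.card) ∂μ := by
    rw [integral_add (integrable_energy hJ R γ) (integrable_const _)]
    simp [meanEnergy]
  rw [h1]
  refine abs_integral_le_integral_abs.trans (le_trans ?_ (integral_totalJ_le hJ hc))
  exact integral_mono_of_nonneg (Eventually.of_forall fun _ => abs_nonneg _)
    ((memLp_totalJ hJ R).integrable one_le_two)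
    (Eventually.of_forall fun ω => abs_energy_add_le R γ ω)

theorem variance_energy_le (hJ : IsShiftInvariantDisorder μ J) {R : Finset (Site D q)} {c : ℝ}
    (hc : ∀ i ∈ R, ∑ j ∈ R, rms μ (J i j) ≤ c) (γ : ℝ) :
    variance (energy J R γ) μ ≤ (c * R.card) ^ 2 := by
  rw [← variance_add_const (aestronglyMeasurable_energy hJ R γ) (|γ| * R.card)]
  refine (variance_le_expectation_sq (memLp_energy_add hJ R γ).aestronglyMeasurable).trans ?_
  refine le_trans ?_ (integral_totalJ_sq_le hJ hc)
  refine integral_mono_of_nonneg (Eventually.of_forall fun _ => sq_nonneg _)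
    (memLp_totalJ hJ R).integrable_sq (Eventually.of_forall fun ω => ?_)
  exact sq_le_sq' (by linarith [(abs_le.1 (abs_energy_add_le (J := J) R γ ω)).1])
    (abs_le.1 (abs_energy_add_le R γ ω)).2

/-- The fluctuation of the energy of the blocks of a decomposition. -/
noncomputable def fluctuation (μ : Measure Ω) (J : Site D q → Site D q → Ω → ℝ)
    (R : Finset (Site D q)) (V : Finset (Fin D → ℤ)) (γ : ℝ) (ω : Ω) : ℝ :=
  ∑ v ∈ V, energy J (translateRegion v R) γ ω - V.card * meanEnergy μ J R γ

theorem meanEnergy_translateRegion (hJ : IsShiftInvariantDisorder μ J) (R : Finset (Site D q))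
    (v : Fin D → ℤ) (γ : ℝ) : meanEnergy μ J (translateRegion v R) γ = meanEnergy μ J R γ :=
  (identDistrib_energy_translateRegion hJ R v γ).integral_eq

theorem memLp_fluctuation (hJ : IsShiftInvariantDisorder μ J) (R : Finset (Site D q))
    (V : Finset (Fin D → ℤ)) (γ : ℝ) : MemLp (fluctuation μ J R V γ) 2 μ :=
  (memLp_finsetSum _ fun _ _ => memLp_energy hJ _ γ).sub (memLp_const _)

theorem integral_fluctuation_sq_le (hJ : IsShiftInvariantDisorder μ J) {R : Finset (Site D q)}
    {c : ℝ} (hc : ∀ i ∈ R, ∑ j ∈ R, rms μ (J i j) ≤ c) {V : Finset (Fin D → ℤ)}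
    (hV : ∀ v ∈ V, ∀ w ∈ V, v ≠ w → Disjoint (translateRegion v R) (translateRegion w R))
    (γ : ℝ) : ∫ ω, fluctuation μ J R V γ ω ^ 2 ∂μ ≤ V.card * (c * R.card) ^ 2 := by
  have h1 : variance (∑ v ∈ V, energy J (translateRegion v R) γ) μ =
      ∑ v ∈ V, variance (energy J (translateRegion v R) γ) μ := by
    refine IndepFun.variance_sum (fun v _ => memLp_energy hJ _ γ) fun v hv w hw hvw => ?_
    exact (indepFun_restrictCouplings hJ (hV v hv w hw hvw)).comp
      (continuous_gsE γ).measurable (continuous_gsE γ).measurable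
  have h2 : ∫ ω, (∑ v ∈ V, energy J (translateRegion v R) γ) ω ∂μ =
      V.card * meanEnergy μ J R γ := by
    simp only [Finset.sum_apply]
    rw [integral_finsetSum _ fun v _ => integrable_energy hJ _ γ]
    refine (Finset.sum_congr rfl fun v _ => meanEnergy_translateRegion hJ R v γ).trans ?_
    rw [Finset.sum_const, nsmul_eq_mul]
  have h3 : ∫ ω, fluctuation μ J R V γ ω ^ 2 ∂μ =
      variance (∑ v ∈ V, energy J (translateRegion v R) γ) μ := by
    have h4 : AEMeasurable (∑ v ∈ V, energy J (translateRegion v R) γ) μ :=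
      Finset.aemeasurable_sum V fun v _ => (aestronglyMeasurable_energy hJ _ γ).aemeasurable
    rw [variance_eq_integral h4, h2]
    simp only [fluctuation, Finset.sum_apply]
  rw [h3, h1, ← nsmul_eq_mul, ← Finset.sum_const]
  refine Finset.sum_le_sum fun v _ => ?_
  rw [(identDistrib_energy_translateRegion hJ R v γ).variance_eq]
  exact variance_energy_le hJ hc γ

theorem integrable_neglectedJ (hJ : IsShiftInvariantDisorder μ J) {ν : Type*} [DecidableEq ν]
    (R : Finset (Site D q)) (V : Finset ν) (T : ν → Finset (Site D q)) :
    Integrable (fun ω => neglectedJ (fun i j => J i j ω) R V T) μ := by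
  have hint (i j) : Integrable (fun ω => |J i j ω|) μ :=
    ((hJ.memLp i j).integrable one_le_two).abs
  exact (integrable_finsetSum _ fun _ _ => integrable_finsetSum _ fun _ _ =>
    integrable_finsetSum _ fun _ _ => hint _ _).add
    (integrable_finsetSum _ fun _ _ => integrable_finsetSum _ fun _ _ => hint _ _)

theorem integral_neglectedJ_le (hJ : IsShiftInvariantDisorder μ J) {ν : Type*} [DecidableEq ν]
    {R : Finset (Site D q)} {V : Finset ν} {T : ν → Finset (Site D q)} {c d : ℝ}
    (hc : ∀ i ∈ R, ∑ j ∈ R, rms μ (J i j) ≤ c)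
    (hd : ∀ v ∈ V, ∑ i ∈ T v, ∑ j ∈ R \ T v, rms μ (J i j) ≤ d) :
    ∫ ω, neglectedJ (fun i j => J i j ω) R V T ∂μ ≤
      d * V.card + c * (R \ V.biUnion T).card := by
  have hint (i j) : Integrable (fun ω => |J i j ω|) μ :=
    ((hJ.memLp i j).integrable one_le_two).abs
  simp only [neglectedJ]
  rw [integral_add (integrable_finsetSum _ fun _ _ => integrable_finsetSum _ fun _ _ =>
    integrable_finsetSum _ fun _ _ => hint _ _)
    (integrable_finsetSum _ fun _ _ => integrable_finsetSum _ fun _ _ => hint _ _)]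
  refine add_le_add ?_ ?_
  · rw [integral_finsetSum _ fun _ _ => integrable_finsetSum _ fun _ _ =>
      integrable_finsetSum _ fun _ _ => hint _ _, mul_comm, ← nsmul_eq_mul, ← Finset.sum_const]
    refine Finset.sum_le_sum fun v hv => le_trans ?_ (hd v hv)
    rw [integral_finsetSum _ fun _ _ => integrable_finsetSum _ fun _ _ => hint _ _]
    refine Finset.sum_le_sum fun i _ => ?_
    rw [integral_finsetSum _ fun _ _ => hint _ _]
    exact Finset.sum_le_sum fun j _ => integral_abs_le_rms (hJ.memLp i j)
  · rw [integral_finsetSum _ fun _ _ => integrable_finsetSum _ fun _ _ => hint _ _, mul_comm,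
      ← nsmul_eq_mul, ← Finset.sum_const]
    refine Finset.sum_le_sum fun i hi => le_trans ?_ (hc i (Finset.mem_sdiff.1 hi).1)
    rw [integral_finsetSum _ fun _ _ => hint _ _]
    exact Finset.sum_le_sum fun j _ => integral_abs_le_rms (hJ.memLp i j)

end Disorder

section Limit

variable {D q : ℕ} {Ω : Type*} [MeasurableSpace Ω] {μ : Measure Ω}
  {J : Site D q → Site D q → Ω → ℝ} {Λ : ℕ → Finset (Site D q)}

/-- A decomposition of the region `L` into translates of the region `R`, by the vectors in `V`,
and single sites, with the constants of finite dimensionality. -/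
structure IsDecomposition (μ : Measure Ω) (J : Site D q → Site D q → Ω → ℝ) (cs cr : ℝ)
    (R L : Finset (Site D q)) (V : Finset (Fin D → ℤ)) : Prop where
  sub : ∀ v ∈ V, translateRegion v R ⊆ L
  disj : ∀ v ∈ V, ∀ w ∈ V, v ≠ w → Disjoint (translateRegion v R) (translateRegion w R)
  surface : ∀ v ∈ V, ∑ i ∈ translateRegion v R, ∑ j ∈ L \ translateRegion v R, rms μ (J i j) ≤
    cs * (R.card * (R.card : ℝ) ^ (-(1 / (D : ℝ))))
  rem : ((L \ V.biUnion fun v => translateRegion v R).card : ℝ) ≤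
    cr * ((R.card / L.card : ℝ) ^ (1 / (D : ℝ)) * L.card)

/-- Finite dimensionality with given nonnegative constants. -/
structure FiniteDimensionalWith (μ : Measure Ω) (J : Site D q → Site D q → Ω → ℝ)
    (Λ : ℕ → Finset (Site D q)) (c cs cr : ℝ) : Prop where
  nonempty : ∀ n, (Λ n).Nonempty
  card_tendsto : Tendsto (fun n => (Λ n).card) atTop atTop
  c_nonneg : 0 ≤ c
  cs_nonneg : 0 ≤ cs
  cr_nonneg : 0 ≤ cr
  bulk : ∀ n, ∀ i ∈ Λ n, ∑ j ∈ Λ n, rms μ (J i j) ≤ c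
  decomposition : ∀ m n, m ≤ n → ∃ V, IsDecomposition μ J cs cr (Λ m) (Λ n) V

theorem IsFiniteDimensional.exists_with (hΛ : IsFiniteDimensional μ J Λ) :
    ∃ c cs cr, FiniteDimensionalWith μ J Λ c cs cr := by
  obtain ⟨c, hc⟩ := hΛ.bulk
  obtain ⟨cs, cr, hdec⟩ := hΛ.decomposition
  refine ⟨max c 0, max cs 0, max cr 0, hΛ.nonempty, hΛ.card_tendsto, le_max_right _ _,
    le_max_right _ _, le_max_right _ _, fun n i hi => (hc n i hi).trans (le_max_left _ _),
    fun m n hmn => ?_⟩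
  obtain ⟨V, h1, h2, h3, h4⟩ := hdec m n hmn
  have hA : (0 : ℝ) < (Λ m).card := by exact_mod_cast (hΛ.nonempty m).card_pos
  have hN : (0 : ℝ) < (Λ n).card := by exact_mod_cast (hΛ.nonempty n).card_pos
  refine ⟨V, h1, h2, fun v hv => (h3 v hv).trans ?_, h4.trans ?_⟩
  · rw [sub_eq_add_neg, Real.rpow_add hA, Real.rpow_one]
    exact mul_le_mul_of_nonneg_right (le_max_left _ _) (by positivity)
  · rw [mul_assoc]
    have : ((Λ m).card : ℝ) ^ (1 / (D : ℝ)) * ((Λ n).card : ℝ) ^ (1 - 1 / (D : ℝ)) =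
        ((Λ m).card / (Λ n).card : ℝ) ^ (1 / (D : ℝ)) * (Λ n).card := by
      rw [Real.div_rpow hA.le hN.le, Real.rpow_sub hN, Real.rpow_one]
      field_simp
    rw [this]
    exact mul_le_mul_of_nonneg_right (le_max_left _ _) (by positivity)

/-- The mean energy per site of the `n`-th system. -/
noncomputable def density (μ : Measure Ω) (J : Site D q → Site D q → Ω → ℝ)
    (Λ : ℕ → Finset (Site D q)) (n : ℕ) (γ : ℝ) : ℝ :=
  meanEnergy μ J (Λ n) γ / (Λ n).card

variable {c cs cr : ℝ}

theorem FiniteDimensionalWith.card_pos (hΛ : FiniteDimensionalWith μ J Λ c cs cr) (n : ℕ) :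
    (0 : ℝ) < (Λ n).card := by exact_mod_cast (hΛ.nonempty n).card_pos

theorem IsDecomposition.card_eq {R L : Finset (Site D q)} {V : Finset (Fin D → ℤ)}
    (h : IsDecomposition μ J cs cr R L V) :
    (L.card : ℝ) = V.card * R.card + (L \ V.biUnion fun v => translateRegion v R).card := by
  have h1 := card_eq_sum_add h.sub h.disj
  simp only [card_translateRegion, Finset.sum_const, smul_eq_mul] at h1
  exact_mod_cast h1

variable [IsProbabilityMeasure μ]

theorem abs_density_add_le (hJ : IsShiftInvariantDisorder μ J)
    (hΛ : FiniteDimensionalWith μ J Λ c cs cr) (n : ℕ) (γ : ℝ) :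
    |density μ J Λ n γ + (|γ|)| ≤ c := by
  have h1 := abs_meanEnergy_add_le hJ (hΛ.bulk n) γ
  have hN := hΛ.card_pos n
  have h2 : meanEnergy μ J (Λ n) γ + |γ| * (Λ n).card =
      (density μ J Λ n γ + |γ|) * (Λ n).card := by
    rw [density]; field_simp
  rw [h2, abs_mul, abs_of_pos hN] at h1
  exact le_of_mul_le_mul_right h1 hN

theorem abs_density_sub_le (hJ : IsShiftInvariantDisorder μ J)
    (hΛ : FiniteDimensionalWith μ J Λ c cs cr) {m n : ℕ} (hmn : m ≤ n) (γ : ℝ) :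
    |density μ J Λ n γ - density μ J Λ m γ| ≤ cs * ((Λ m).card : ℝ) ^ (-(1 / (D : ℝ))) +
      2 * c * cr * ((Λ m).card / (Λ n).card : ℝ) ^ (1 / (D : ℝ)) := by
  obtain ⟨V, hV⟩ := hΛ.decomposition m n hmn
  have hA := hΛ.card_pos m
  have hN := hΛ.card_pos n
  have hcard := hV.card_eq
  have herr := integral_neglectedJ_le hJ (hΛ.bulk n) hV.surface
  have hrem := hV.rem
  set ρ := ((Λ m).card / (Λ n).card : ℝ) ^ (1 / (D : ℝ))
  set s := ((Λ m).card : ℝ) ^ (-(1 / (D : ℝ))) with hs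
  have hs0 : 0 ≤ s := by positivity
  set A : ℝ := ((Λ m).card : ℝ) with hA_def
  set N : ℝ := ((Λ n).card : ℝ) with hN_def
  set B : ℝ := (V.card : ℝ) with hB
  have hB0 : 0 ≤ B := by positivity
  set r : ℝ := ((Λ n \ V.biUnion fun v => translateRegion v (Λ m)).card : ℝ) with hr
  have hr0 : 0 ≤ r := by positivity
  have hmean : |meanEnergy μ J (Λ n) γ - (B * meanEnergy μ J (Λ m) γ - |γ| * r)| ≤
      ∫ ω, neglectedJ (fun i j => J i j ω) (Λ n) V (fun v => translateRegion v (Λ m)) ∂μ := by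
    have h1 : meanEnergy μ J (Λ n) γ - (B * meanEnergy μ J (Λ m) γ - |γ| * r) =
        ∫ ω, (energy J (Λ n) γ ω - (∑ v ∈ V, energy J (translateRegion v (Λ m)) γ ω
          - |γ| * r)) ∂μ := by
      have hi : Integrable (fun ω => ∑ v ∈ V, energy J (translateRegion v (Λ m)) γ ω) μ :=
        integrable_finsetSum _ fun v _ => integrable_energy hJ _ γ
      have hi2 : Integrable (fun ω => ∑ v ∈ V, energy J (translateRegion v (Λ m)) γ ω - |γ| * r)
          μ := hi.sub (integrable_const _)
      rw [integral_sub (integrable_energy hJ _ γ) hi2,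
        integral_sub hi (integrable_const _),
        integral_finsetSum _ fun v _ => integrable_energy hJ _ γ]
      have h2 : ∑ v ∈ V, ∫ ω, energy J (translateRegion v (Λ m)) γ ω ∂μ =
          B * meanEnergy μ J (Λ m) γ := by
        refine (Finset.sum_congr rfl fun v _ => meanEnergy_translateRegion hJ _ v γ).trans ?_
        rw [Finset.sum_const, nsmul_eq_mul]
      rw [h2]
      simp [meanEnergy]
    rw [h1]
    refine abs_integral_le_integral_abs.trans ?_
    exact integral_mono_of_nonneg (Eventually.of_forall fun _ => abs_nonneg _)
      (integrable_neglectedJ hJ _ _ _) (Eventually.of_forall fun ω =>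
        abs_gsE_sub_sum_blocks_le hV.sub hV.disj (hΛ.nonempty n) (fun i j => J i j ω) γ)
  have hm := abs_density_add_le hJ hΛ m γ
  have hn1 : meanEnergy μ J (Λ n) γ = density μ J Λ n γ * N := by
    rw [density, div_mul_cancel₀ _ hN.ne']
  have hm1 : meanEnergy μ J (Λ m) γ = density μ J Λ m γ * A := by
    rw [density, div_mul_cancel₀ _ hA.ne']
  rw [hn1, hm1] at hmean
  set x := density μ J Λ n γ
  set y := density μ J Λ m γ
  have h3 : (x - y) * N = (x * N - (B * (y * A) - |γ| * r)) - r * (y + |γ|) := by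
    rw [hcard]; ring
  have h4 : |r * (y + |γ|)| ≤ c * r := by
    rw [abs_mul, abs_of_nonneg hr0, mul_comm]; exact mul_le_mul_of_nonneg_right hm hr0
  have h5 : |(x - y) * N| ≤ cs * (A * s) * B + c * r + c * r := by
    rw [h3]; exact (abs_sub _ _).trans (add_le_add (hmean.trans herr) h4)
  rw [abs_mul, abs_of_pos hN] at h5
  refine le_of_mul_le_mul_right (h5.trans ?_) hN
  have h6 : cs * (A * s) * B ≤ cs * s * N := by
    have : B * A ≤ N := by linarith
    have := mul_le_mul_of_nonneg_left this (mul_nonneg hΛ.cs_nonneg hs0)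
    linarith
  have h7 : c * r ≤ c * (cr * (ρ * N)) := mul_le_mul_of_nonneg_left hrem hΛ.c_nonneg
  linarith

theorem tendsto_card_rpow_neg (hD : 0 < D) (hΛ : FiniteDimensionalWith μ J Λ c cs cr) :
    Tendsto (fun m => ((Λ m).card : ℝ) ^ (-(1 / (D : ℝ)))) atTop (𝓝 0) :=
  (tendsto_rpow_neg_atTop (by positivity)).comp
    (tendsto_natCast_atTop_atTop.comp hΛ.card_tendsto)

theorem tendsto_div_card_rpow (hD : 0 < D) (hΛ : FiniteDimensionalWith μ J Λ c cs cr) (a : ℝ) :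
    Tendsto (fun n => (a / (Λ n).card : ℝ) ^ (1 / (D : ℝ))) atTop (𝓝 0) := by
  have hp : (0 : ℝ) < 1 / (D : ℝ) := by positivity
  have h1 : Tendsto (fun n => a / ((Λ n).card : ℝ)) atTop (𝓝 0) :=
    tendsto_const_nhds.div_atTop (tendsto_natCast_atTop_atTop.comp hΛ.card_tendsto)
  have h2 := h1.rpow_const (p := 1 / (D : ℝ)) (Or.inr hp.le)
  rwa [Real.zero_rpow hp.ne'] at h2

theorem exists_tendsto_density (hD : 0 < D) (hJ : IsShiftInvariantDisorder μ J)
    (hΛ : FiniteDimensionalWith μ J Λ c cs cr) (γ : ℝ) :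
    ∃ x, Tendsto (fun n => density μ J Λ n γ) atTop (𝓝 x) := by
  refine cauchySeq_tendsto_of_complete (Metric.cauchySeq_iff'.2 fun ε hε => ?_)
  have h1 : Tendsto (fun m => cs * ((Λ m).card : ℝ) ^ (-(1 / (D : ℝ)))) atTop (𝓝 0) := by
    simpa using (tendsto_card_rpow_neg hD hΛ).const_mul cs
  obtain ⟨m, hm⟩ := (h1.eventually (gt_mem_nhds (show 0 < ε / 4 by positivity))).exists
  have h2 : Tendsto (fun n => 2 * c * cr * ((Λ m).card / (Λ n).card : ℝ) ^ (1 / (D : ℝ))) atTop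
      (𝓝 0) := by
    simpa using (tendsto_div_card_rpow hD hΛ (Λ m).card).const_mul (2 * c * cr)
  obtain ⟨n₀, hn₀⟩ := eventually_atTop.1 (h2.eventually (gt_mem_nhds (show 0 < ε / 4 by positivity)))
  have h3 (n) (hn : max m n₀ ≤ n) : |density μ J Λ n γ - density μ J Λ m γ| < ε / 2 := by
    have := abs_density_sub_le hJ hΛ ((le_max_left _ _).trans hn) γ
    have := hn₀ n ((le_max_right _ _).trans hn)
    linarith
  refine ⟨max m n₀, fun n hn => ?_⟩
  have h4 := abs_lt.1 (h3 n hn)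
  have h5 := abs_lt.1 (h3 _ le_rfl)
  rw [Real.dist_eq, abs_lt]
  constructor <;> linarith

theorem abs_limit_sub_density_le (hD : 0 < D) (hJ : IsShiftInvariantDisorder μ J)
    (hΛ : FiniteDimensionalWith μ J Λ c cs cr) {γ x : ℝ}
    (hx : Tendsto (fun n => density μ J Λ n γ) atTop (𝓝 x)) (m : ℕ) :
    |x - density μ J Λ m γ| ≤ cs * ((Λ m).card : ℝ) ^ (-(1 / (D : ℝ))) := by
  have h2 : Tendsto (fun n => cs * ((Λ m).card : ℝ) ^ (-(1 / (D : ℝ))) +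
      2 * c * cr * ((Λ m).card / (Λ n).card : ℝ) ^ (1 / (D : ℝ))) atTop
      (𝓝 (cs * ((Λ m).card : ℝ) ^ (-(1 / (D : ℝ))))) := by
    simpa using ((tendsto_div_card_rpow hD hΛ (Λ m).card).const_mul (2 * c * cr)).const_add
      (cs * ((Λ m).card : ℝ) ^ (-(1 / (D : ℝ))))
  exact le_of_tendsto_of_tendsto (hx.sub_const _).abs h2
    (eventually_atTop.2 ⟨m, fun n hn => abs_density_sub_le hJ hΛ hn γ⟩)

theorem monotone_density_add (hJ : IsShiftInvariantDisorder μ J)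
    (hΛ : FiniteDimensionalWith μ J Λ c cs cr) (n : ℕ) :
    Monotone fun γ => density μ J Λ n γ + γ := by
  intro a b hab
  have hN := hΛ.card_pos n
  have h1 : meanEnergy μ J (Λ n) a ≤ meanEnergy μ J (Λ n) b + (b - a) * (Λ n).card := by
    have h2 : meanEnergy μ J (Λ n) b + (b - a) * (Λ n).card =
        ∫ ω, (energy J (Λ n) b ω + (b - a) * (Λ n).card) ∂μ := by
      rw [integral_add (integrable_energy hJ _ b) (integrable_const _)]
      simp [meanEnergy]
    rw [h2]
    refine integral_mono (integrable_energy hJ _ a)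
      ((integrable_energy hJ _ b).add (integrable_const _)) fun ω => ?_
    have h3 := monotone_gsE_add (restrictCouplings J (Λ n) ω) hab
    simp only [Fintype.card_coe] at h3
    simp only [energy]
    linarith
  dsimp only [density]
  rw [← le_sub_iff_add_le, div_le_iff₀ hN]
  refine h1.trans (le_of_eq ?_)
  field_simp
  ring

theorem antitone_density_sub (hJ : IsShiftInvariantDisorder μ J)
    (hΛ : FiniteDimensionalWith μ J Λ c cs cr) (n : ℕ) :
    Antitone fun γ => density μ J Λ n γ - γ := by
  intro a b hab
  have hN := hΛ.card_pos n
  have h1 : meanEnergy μ J (Λ n) b ≤ meanEnergy μ J (Λ n) a + (b - a) * (Λ n).card := by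
    have h2 : meanEnergy μ J (Λ n) a + (b - a) * (Λ n).card =
        ∫ ω, (energy J (Λ n) a ω + (b - a) * (Λ n).card) ∂μ := by
      rw [integral_add (integrable_energy hJ _ a) (integrable_const _)]
      simp [meanEnergy]
    rw [h2]
    refine integral_mono (integrable_energy hJ _ b)
      ((integrable_energy hJ _ a).add (integrable_const _)) fun ω => ?_
    have h3 := antitone_gsE_sub (restrictCouplings J (Λ n) ω) hab
    simp only [Fintype.card_coe] at h3
    simp only [energy]
    linarith
  dsimp only [density]
  rw [sub_le_iff_le_add, div_le_iff₀ hN]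
  refine h1.trans (le_of_eq ?_)
  field_simp
  ring

theorem concaveOn_density (hJ : IsShiftInvariantDisorder μ J)
    (hΛ : FiniteDimensionalWith μ J Λ c cs cr) (n : ℕ) :
    ConcaveOn ℝ Set.univ (density μ J Λ n) := by
  refine ⟨convex_univ, fun x _ y _ a b ha hb hab => ?_⟩
  have hN := hΛ.card_pos n
  simp only [density, smul_eq_mul]
  rw [mul_div_assoc', mul_div_assoc', ← add_div]
  refine div_le_div_of_nonneg_right ?_ hN.le
  have h2 : a * meanEnergy μ J (Λ n) x + b * meanEnergy μ J (Λ n) y =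
      ∫ ω, (a * energy J (Λ n) x ω + b * energy J (Λ n) y ω) ∂μ := by
    rw [integral_add ((integrable_energy hJ _ x).const_mul a)
      ((integrable_energy hJ _ y).const_mul b), integral_const_mul, integral_const_mul]
    rfl
  rw [h2]
  refine integral_mono (((integrable_energy hJ _ x).const_mul a).add
    ((integrable_energy hJ _ y).const_mul b)) (integrable_energy hJ _ _) fun ω => ?_
  simpa [energy] using (concaveOn_gsE (restrictCouplings J (Λ n) ω)).2 (Set.mem_univ x)
    (Set.mem_univ y) ha hb hab

/-- The properties of the limit of the mean energy density. -/
structure IsLimitDensity (μ : Measure Ω) (J : Site D q → Site D q → Ω → ℝ)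
    (Λ : ℕ → Finset (Site D q)) (c cs : ℝ) (e : ℝ → ℝ) : Prop where
  tendsto : ∀ γ, Tendsto (fun n => density μ J Λ n γ) atTop (𝓝 (e γ))
  abs_sub_le : ∀ n γ, |e γ - density μ J Λ n γ| ≤ cs * ((Λ n).card : ℝ) ^ (-(1 / (D : ℝ)))
  abs_add_le : ∀ γ, |e γ + (|γ|)| ≤ c
  concaveOn : ConcaveOn ℝ Set.univ e
  monotone : Monotone fun γ => e γ + γ
  continuous : Continuous e

theorem exists_isLimitDensity (hD : 0 < D) (hJ : IsShiftInvariantDisorder μ J)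
    (hΛ : FiniteDimensionalWith μ J Λ c cs cr) : ∃ e, IsLimitDensity μ J Λ c cs e := by
  choose e he using exists_tendsto_density hD hJ hΛ
  have hmono : Monotone fun γ => e γ + γ := fun a b hab =>
    le_of_tendsto_of_tendsto' ((he a).add_const a) ((he b).add_const b)
      fun n => monotone_density_add hJ hΛ n hab
  have hanti : Antitone fun γ => e γ - γ := fun a b hab =>
    le_of_tendsto_of_tendsto' ((he b).sub_const b) ((he a).sub_const a)
      fun n => antitone_density_sub hJ hΛ n hab
  refine ⟨e, he, fun n γ => abs_limit_sub_density_le hD hJ hΛ (he γ) n, fun γ => ?_, ?_, hmono, ?_⟩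
  · exact le_of_tendsto' ((he γ).add_const _).abs fun n => abs_density_add_le hJ hΛ n γ
  · refine ⟨convex_univ, fun x hx y hy a b ha hb hab => ?_⟩
    exact le_of_tendsto_of_tendsto' (((he x).const_smul a).add ((he y).const_smul b)) (he _)
      fun n => (concaveOn_density hJ hΛ n).2 hx hy ha hb hab
  · have hL : LipschitzWith 1 e := by
      refine LipschitzWith.of_le_add fun x y => ?_
      rw [Real.dist_eq]
      rcases le_total x y with h | h
      · have := hmono h
        dsimp only at this
        rw [abs_sub_comm, abs_of_nonneg (sub_nonneg.2 h)]
        linarith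
      · have := hanti h
        dsimp only at this
        rw [abs_of_nonneg (sub_nonneg.2 h)]
        linarith
    exact hL.continuous

end Limit

/-- Two monotone functions, one of them continuous, are close on an interval if they are close on
a suitable finite set that depends only on the continuous one. -/
theorem exists_grid {h : ℝ → ℝ} (hmono : Monotone h) (hcont : Continuous h) {a b : ℝ}
    (hab : a ≤ b) {K : ℕ} (hK : 0 < K) :
    ∃ t : ℕ → ℝ, ∀ g : ℝ → ℝ, Monotone g → ∀ M : ℝ,
      (∀ j ∈ Finset.range (K + 1), |g (t j) - h (t j)| ≤ M) →
      ∀ x ∈ Set.Icc a b, |g x - h x| ≤ M + (h b - h a) / K := by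
  have hK0 : (0 : ℝ) < K := by exact_mod_cast hK
  have hd : 0 ≤ (h b - h a) / K := div_nonneg (sub_nonneg.2 (hmono hab)) hK0.le
  have hex (j : ℕ) : ∃ t : ℝ, j ≤ K →
      h t = h a + j * ((h b - h a) / K) ∧ (j = 0 → t = a) ∧ (j = K → t = b) := by
    by_cases h0 : j = 0
    · exact ⟨a, fun _ => ⟨by simp [h0], fun _ => rfl, fun h1 => by omega⟩⟩
    by_cases h1 : j = K
    · refine ⟨b, fun _ => ⟨?_, fun h2 => absurd h2 h0, fun _ => rfl⟩⟩
      rw [h1]; field_simp; ring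
    by_cases h2 : j ≤ K
    · have hj : (j : ℝ) ≤ K := by exact_mod_cast h2
      have hmem : h a + j * ((h b - h a) / K) ∈ Set.Icc (h a) (h b) := by
        refine ⟨by nlinarith [Nat.cast_nonneg (α := ℝ) j], ?_⟩
        calc h a + j * ((h b - h a) / K) ≤ h a + K * ((h b - h a) / K) := by gcongr
          _ = h b := by field_simp; ring
      obtain ⟨t, -, ht⟩ := intermediate_value_Icc hab hcont.continuousOn hmem
      exact ⟨t, fun _ => ⟨ht, fun h3 => absurd h3 h0, fun h3 => absurd h3 h1⟩⟩
    · exact ⟨a, fun h3 => absurd h3 h2⟩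
  choose t ht using hex
  refine ⟨t, fun g hg M hM x hx => ?_⟩
  have hM' (j) (hj : j ≤ K) := abs_le.1 (hM j (Finset.mem_range.2 (Nat.lt_succ_of_le hj)))
  have hexj : ∃ j, j ≤ K ∧ x ≤ t j := ⟨K, le_rfl, by rw [(ht K le_rfl).2.2 rfl]; exact hx.2⟩
  classical
  obtain ⟨hjK, hxj⟩ := Nat.find_spec hexj
  rcases Nat.eq_zero_or_pos (Nat.find hexj) with h0 | hpos
  · have hxa : x = t 0 := by
      rw [(ht 0 (Nat.zero_le _)).2.1 rfl]
      rw [h0, (ht 0 (Nat.zero_le _)).2.1 rfl] at hxj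
      exact le_antisymm hxj hx.1
    rw [hxa]
    have := hM' 0 (Nat.zero_le _)
    rw [abs_le]
    constructor <;> linarith
  · obtain ⟨i, hi⟩ : ∃ i, Nat.find hexj = i + 1 := ⟨Nat.find hexj - 1, by omega⟩
    rw [hi] at hjK hxj
    have hti : t i ≤ x := by
      by_contra! hlt
      exact Nat.find_min hexj (by omega : i < Nat.find hexj) ⟨by omega, hlt.le⟩
    have e1 := (ht i (by omega)).1
    have e2 := (ht (i + 1) hjK).1
    push_cast at e2
    have b1 := hM' i (by omega)
    have b2 := hM' (i + 1) hjK
    have m1 := hg hti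
    have m2 := hg hxj
    have m3 := hmono hti
    have m4 := hmono hxj
    rw [abs_le]
    constructor <;> linarith

section Estimate

variable {D q : ℕ} {Ω : Type*} [MeasurableSpace Ω] {μ : Measure Ω}
  {J : Site D q → Site D q → Ω → ℝ} {Λ : ℕ → Finset (Site D q)} {c cs cr : ℝ}
  [IsProbabilityMeasure μ]

theorem integral_const_mul_add {f : Ω → ℝ} (hf : Integrable f μ) (a b : ℝ) :
    ∫ ω, (a * f ω + b) ∂μ = a * ∫ ω, f ω ∂μ + b := by
  rw [integral_add (hf.const_mul a) (integrable_const b), integral_const_mul]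
  simp

/-- The energy of the blocks of a decomposition, compared with the limit. -/
theorem abs_sum_energy_sub_le (hΛ : FiniteDimensionalWith μ J Λ c cs cr)
    {e : ℝ → ℝ} (he : IsLimitDensity μ J Λ c cs e) {m n : ℕ}
    {V : Finset (Fin D → ℤ)} (hV : IsDecomposition μ J cs cr (Λ m) (Λ n) V) (x : ℝ) (ω : Ω) :
    |∑ v ∈ V, energy J (translateRegion v (Λ m)) x ω -
      |x| * (Λ n \ V.biUnion fun v => translateRegion v (Λ m)).card - (Λ n).card * e x| ≤
    |fluctuation μ J (Λ m) V x ω| + (cs * ((Λ m).card : ℝ) ^ (-(1 / (D : ℝ))) * (Λ n).card +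
      c * (Λ n \ V.biUnion fun v => translateRegion v (Λ m)).card) := by
  have hcard := hV.card_eq
  set A : ℝ := ((Λ m).card : ℝ) with hA
  set N : ℝ := ((Λ n).card : ℝ) with hN
  set B : ℝ := (V.card : ℝ) with hB
  set r : ℝ := ((Λ n \ V.biUnion fun v => translateRegion v (Λ m)).card : ℝ) with hr
  have hA0 : 0 < A := hΛ.card_pos m
  have hr0 : 0 ≤ r := by positivity
  have hB0 : 0 ≤ B := by positivity
  have h1 := he.abs_sub_le m x
  have h2 := he.abs_add_le x
  have hm1 : meanEnergy μ J (Λ m) x = density μ J Λ m x * A := by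
    rw [density, div_mul_cancel₀ _ hA0.ne']
  rw [← hA] at h1
  set s := A ^ (-(1 / (D : ℝ)))
  set y := density μ J Λ m x
  have h3 : ∑ v ∈ V, energy J (translateRegion v (Λ m)) x ω - |x| * r - N * e x =
      fluctuation μ J (Λ m) V x ω + (-(B * A * (e x - y)) - r * (e x + |x|)) := by
    rw [fluctuation, hm1, hcard, ← hB]; ring
  rw [h3]
  refine (abs_add_le _ _).trans (add_le_add_right ?_ _)
  refine (abs_sub _ _).trans (add_le_add ?_ ?_)
  · rw [abs_neg, abs_mul, abs_of_nonneg (mul_nonneg hB0 hA0.le), mul_comm]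
    refine mul_le_mul h1 (by linarith) (mul_nonneg hB0 hA0.le) ((abs_nonneg _).trans h1)
  · rw [abs_mul, abs_of_nonneg hr0, mul_comm]
    exact mul_le_mul_of_nonneg_right h2 hr0

theorem monotone_sum_energy {m n : ℕ} {V : Finset (Fin D → ℤ)}
    (hV : IsDecomposition μ J cs cr (Λ m) (Λ n) V) (ω : Ω) :
    Monotone fun x => ∑ v ∈ V, energy J (translateRegion v (Λ m)) x ω -
      |x| * (Λ n \ V.biUnion fun v => translateRegion v (Λ m)).card + x * (Λ n).card := by
  have hcard := hV.card_eq
  set r : ℝ := ((Λ n \ V.biUnion fun v => translateRegion v (Λ m)).card : ℝ) with hr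
  have hr0 : 0 ≤ r := by positivity
  have h1 : Monotone fun x => ∑ v ∈ V, (energy J (translateRegion v (Λ m)) x ω +
      x * (Λ m).card) := by
    intro a b hab
    refine Finset.sum_le_sum fun v _ => ?_
    have := monotone_gsE_add (restrictCouplings J (translateRegion v (Λ m)) ω)
    simp only [Fintype.card_coe, card_translateRegion] at this
    exact this hab
  have h2 : Monotone fun x : ℝ => r * (x - |x|) := by
    intro a b hab
    refine mul_le_mul_of_nonneg_left ?_ hr0
    have := abs_sub_abs_le_abs_sub b a
    rw [abs_of_nonneg (sub_nonneg.2 hab)] at this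
    linarith
  have h3 : (fun x => ∑ v ∈ V, energy J (translateRegion v (Λ m)) x ω - |x| * r +
      x * (Λ n).card) = fun x => ∑ v ∈ V, (energy J (translateRegion v (Λ m)) x ω +
      x * (Λ m).card) + r * (x - |x|) := by
    ext x
    rw [Finset.sum_add_distrib, Finset.sum_const, nsmul_eq_mul, hcard]
    ring
  rw [h3]
  exact h1.add h2

/-- The mean square deviation in terms of the data of a decomposition. -/
theorem lintegral_deviationUpTo_sq_le (hJ : IsShiftInvariantDisorder μ J)
    (hΛ : FiniteDimensionalWith μ J Λ c cs cr) {e : ℝ → ℝ} (he : IsLimitDensity μ J Λ c cs e)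
    {α : ℝ} (hα : 0 < α) {mS : ℝ → ℝ} (hself : ∀ γ, IsSelfConsistent e α γ (mS γ))
    (hmS : ∀ γ, |mS γ| ≤ 1) {m n : ℕ} {V : Finset (Fin D → ℤ)}
    (hV : IsDecomposition μ J cs cr (Λ m) (Λ n) V) {A N s r : ℝ} (hA : A = (Λ m).card)
    (hN : N = (Λ n).card) (hs : s = A ^ (-(1 / (D : ℝ))))
    (hr : r = (Λ n \ V.biUnion fun v => translateRegion v (Λ m)).card)
    {K : ℕ} (hK : 0 < K) {δ : ℝ} (hδ : 0 < δ) (Γ : ℕ) :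
    ∫⁻ ω, deviationUpTo (restrictCouplings J (Λ n) ω) α mS Γ ^ 2 ∂μ ≤
      ENNReal.ofReal ((α * N)⁻¹ * (2 * (((K + 1) * (c ^ 2 * A * N) / (N * δ) + N * δ) / 2 +
        (cs * s * N + c * r) + N * (2 * c + 4 * α) / K) + 2 * (cs * s * N + c * r) +
        6 * α * (A + 1))) := by
  have hcard := hV.card_eq
  have herr := integral_neglectedJ_le hJ (hΛ.bulk n) hV.surface
  have hA0 : 0 < A := hA ▸ hΛ.card_pos m
  have hN0 : 0 < N := hN ▸ hΛ.card_pos n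
  have hA1 : 1 ≤ A := by rw [hA]; exact_mod_cast (hΛ.nonempty m).card_pos
  have hK0 : (0 : ℝ) < K := by exact_mod_cast hK
  rw [← hA, ← hN, ← hr] at hcard
  rw [← hA, ← hs, ← hr] at herr
  set B : ℝ := (V.card : ℝ) with hB
  have hB0 : 0 ≤ B := by positivity
  have hr0 : 0 ≤ r := by rw [hr]; positivity
  have hs0 : 0 ≤ s := by rw [hs]; positivity
  have hBA : B * A ≤ N := by linarith
  have hc0 := hΛ.c_nonneg
  have hcs0 := hΛ.cs_nonneg
  set b : ℝ := Γ + 2 * α with hb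
  have hab : -(2 * α) ≤ b := by rw [hb]; linarith [Nat.cast_nonneg (α := ℝ) Γ]
  obtain ⟨t, ht⟩ := exists_grid (h := fun x => N * (e x + x))
    (he.monotone.const_mul hN0.le) (by have := he.continuous; fun_prop) hab hK
  let F : Ω → ℝ := fun ω => ∑ j ∈ Finset.range (K + 1), fluctuation μ J (Λ m) V (t j) ω ^ 2
  let Δ : Ω → ℝ := fun ω => (F ω / (N * δ) + N * δ) / 2 + (cs * s * N + c * r) +
    N * (2 * c + 4 * α) / K
  let X : Ω → ℝ := fun ω => neglectedJ (fun i j => J i j ω) (Λ n) V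
    fun v => translateRegion v (Λ m)
  let Z : Ω → ℝ := fun ω => (α * N)⁻¹ * (2 * Δ ω + 2 * X ω + 6 * α * (A + 1))
  have hF0 (ω) : 0 ≤ F ω := Finset.sum_nonneg fun _ _ => sq_nonneg _
  have hX0 (ω) : 0 ≤ X ω := by
    refine add_nonneg (Finset.sum_nonneg fun _ _ => Finset.sum_nonneg fun _ _ =>
      Finset.sum_nonneg fun _ _ => abs_nonneg _) (Finset.sum_nonneg fun _ _ =>
      Finset.sum_nonneg fun _ _ => abs_nonneg _)
  have hΔ0 (ω) : 0 ≤ Δ ω := by have := hF0 ω; positivity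
  have hZ0 (ω) : 0 ≤ Z ω := by have := hΔ0 ω; have := hX0 ω; positivity
  have hrange : (N * (e b + b) - N * (e (-(2 * α)) + -(2 * α))) / K ≤
      N * (2 * c + 4 * α) / K := by
    have h1 := (abs_le.1 (he.abs_add_le b)).2
    have h2 := (abs_le.1 (he.abs_add_le (-(2 * α)))).1
    rw [abs_neg, abs_of_nonneg (by positivity)] at h2
    have h3 := le_abs_self b
    refine div_le_div_of_nonneg_right ?_ hK0.le
    rw [← mul_sub]
    exact mul_le_mul_of_nonneg_left (by linarith) hN0.le
  have hmain (ω) (x) (hx1 : -(2 * α) ≤ x) (hx2 : x ≤ b) :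
      |∑ v ∈ V, energy J (translateRegion v (Λ m)) x ω - |x| * r - N * e x| ≤ Δ ω := by
    have hg := monotone_sum_energy hV ω
    rw [← hr, ← hN] at hg
    have h1 := ht _ hg ((F ω / (N * δ) + N * δ) / 2 + (cs * s * N + c * r)) (fun j hj => by
      have h2 := abs_sum_energy_sub_le hΛ he hV (t j) ω
      rw [← hr, ← hN, ← hA, ← hs] at h2
      have h3 : |fluctuation μ J (Λ m) V (t j) ω| ≤ (F ω / (N * δ) + N * δ) / 2 := by
        have h4 : fluctuation μ J (Λ m) V (t j) ω ^ 2 ≤ F ω :=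
          Finset.single_le_sum (f := fun j => fluctuation μ J (Λ m) V (t j) ω ^ 2)
            (fun _ _ => sq_nonneg _) hj
        have h5 : 0 < N * δ := by positivity
        set y := |fluctuation μ J (Λ m) V (t j) ω| with hy
        rw [← sq_abs, ← hy] at h4
        have h6 : y ^ 2 / (N * δ) ≤ F ω / (N * δ) := div_le_div_of_nonneg_right h4 h5.le
        have h7 : y ≤ (y ^ 2 / (N * δ) + N * δ) / 2 := by
          rw [div_add' _ _ _ h5.ne', div_div, le_div_iff₀ (by positivity)]
          nlinarith [sq_nonneg (y - N * δ)]
        linarith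
      have h8 : ∑ v ∈ V, energy J (translateRegion v (Λ m)) (t j) ω - |t j| * r + t j * N -
          N * (e (t j) + t j) =
          ∑ v ∈ V, energy J (translateRegion v (Λ m)) (t j) ω - |t j| * r - N * e (t j) := by ring
      rw [h8]
      linarith) x ⟨hx1, hx2⟩
    have h9 : ∑ v ∈ V, energy J (translateRegion v (Λ m)) x ω - |x| * r + x * N -
        N * (e x + x) =
        ∑ v ∈ V, energy J (translateRegion v (Λ m)) x ω - |x| * r - N * e x := by ring
    rw [h9] at h1
    exact h1.trans (add_le_add_right hrange _)
  have hdev (ω) : deviationUpTo (restrictCouplings J (Λ n) ω) α mS Γ ^ 2 ≤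
      ENNReal.ofReal (Z ω) := by
    have h1 : deviationUpTo (restrictCouplings J (Λ n) ω) α mS Γ ≤
        ENNReal.ofReal (Real.sqrt (Z ω)) := by
      refine iSup₂_le fun γ hγ => iSup₂_le fun ψ hψ => ENNReal.ofReal_le_ofReal ?_
      refine Real.abs_le_sqrt ?_
      have h2 := sq_sub_le_of_mem_groundStates_region hV.sub hV.disj (fun i j => J i j ω) hα
        (hmS γ) (hself γ) hN hN0 (Δ := Δ ω) (fun x hx1 hx2 => by
          rw [← hr]
          exact hmain ω x (by linarith [hγ.1]) (by rw [hb]; linarith [hγ.2])) hψ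
      have h3 : 6 * α / N * (∑ v ∈ V, ((translateRegion v (Λ m)).card : ℝ) ^ 2 +
          (Λ n \ V.biUnion fun v => translateRegion v (Λ m)).card) ≤ 6 * α * (A + 1) := by
        simp only [card_translateRegion, Finset.sum_const, nsmul_eq_mul]
        rw [← hr, ← hA, ← hB, div_mul_eq_mul_div, div_le_iff₀ hN0, mul_assoc (6 * α)]
        refine mul_le_mul_of_nonneg_left ?_ (by positivity)
        nlinarith
      simp only [Z]
      rw [inv_mul_eq_div, le_div_iff₀ (by positivity), mul_comm]
      exact h2.trans (add_le_add_right h3 _)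
    calc _ ≤ ENNReal.ofReal (Real.sqrt (Z ω)) ^ 2 := by gcongr
      _ = ENNReal.ofReal (Z ω) := by
        rw [← ENNReal.ofReal_pow (Real.sqrt_nonneg _), Real.sq_sqrt (hZ0 ω)]
  have hFint : Integrable F μ := integrable_finsetSum _ fun j _ =>
    (memLp_fluctuation hJ (Λ m) V (t j)).integrable_sq
  have hΔint : Integrable Δ μ :=
    ((((hFint.div_const _).add (integrable_const _)).div_const _).add (integrable_const _)).add
      (integrable_const _)
  have hXint : Integrable X μ := integrable_neglectedJ hJ _ _ _
  have hZint : Integrable Z μ :=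
    ((((hΔint.const_mul 2).add (hXint.const_mul 2))).add (integrable_const _)).const_mul _
  have hFle : ∫ ω, F ω ∂μ ≤ (K + 1) * (c ^ 2 * A * N) := by
    simp only [F]
    rw [integral_finsetSum _ fun j _ => (memLp_fluctuation hJ (Λ m) V (t j)).integrable_sq]
    calc _ ≤ ∑ j ∈ Finset.range (K + 1), c ^ 2 * A * N := by
          refine Finset.sum_le_sum fun j _ => ?_
          refine (integral_fluctuation_sq_le hJ (hΛ.bulk m) hV.disj (t j)).trans ?_
          rw [← hA, ← hB]
          have := mul_le_mul_of_nonneg_left hBA (show 0 ≤ c ^ 2 * A by positivity)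
          linarith
      _ = _ := by simp
  have hXle : ∫ ω, X ω ∂μ ≤ cs * s * N + c * r := by
    refine herr.trans (add_le_add_left ?_ _)
    have := mul_le_mul_of_nonneg_left hBA (show 0 ≤ cs * s by positivity)
    linarith
  have hΔeq : ∫ ω, Δ ω ∂μ = ((∫ ω, F ω ∂μ) / (N * δ) + N * δ) / 2 + (cs * s * N + c * r) +
      N * (2 * c + 4 * α) / K := by
    have h1 (ω) : Δ ω = (2 * (N * δ))⁻¹ * F ω +
        (N * δ / 2 + (cs * s * N + c * r) + N * (2 * c + 4 * α) / K) := by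
      simp only [Δ]; field_simp; ring
    simp only [h1]
    rw [integral_const_mul_add hFint]
    field_simp
    ring
  have hZeq : ∫ ω, Z ω ∂μ =
      (α * N)⁻¹ * (2 * ∫ ω, Δ ω ∂μ + 2 * ∫ ω, X ω ∂μ + 6 * α * (A + 1)) := by
    have h1 (ω) : Z ω = (α * N)⁻¹ * 2 * (Δ ω + X ω) + (α * N)⁻¹ * (6 * α * (A + 1)) := by
      simp only [Z]; ring
    simp only [h1]
    have hΔX : Integrable (fun ω => Δ ω + X ω) μ := hΔint.add hXint
    rw [integral_const_mul_add hΔX, integral_add hΔint hXint]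
    ring
  refine (lintegral_mono hdev).trans ?_
  rw [← ofReal_integral_eq_lintegral_ofReal hZint (Eventually.of_forall hZ0)]
  refine ENNReal.ofReal_le_ofReal ?_
  rw [hZeq, hΔeq]
  gcongr

end Estimate

section Rate

variable {D q : ℕ} {Ω : Type*} [MeasurableSpace Ω] {μ : Measure Ω}
  {J : Site D q → Site D q → Ω → ℝ} {Λ : ℕ → Finset (Site D q)}

theorem IsFiniteDimensional.exists_card_between (hΛ : IsFiniteDimensional μ J Λ) :
    ∃ C : ℝ, 1 ≤ C ∧ ∀ (n : ℕ) (T : ℝ), 1 ≤ T → T ≤ (Λ n).card →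
      ∃ m ≤ n, T ≤ (Λ m).card ∧ ((Λ m).card : ℝ) ≤ C * T := by
  obtain ⟨c, hc⟩ := hΛ.card_succ_le
  refine ⟨max (max c (Λ 0).card) 1, le_max_right _ _, fun n T hT hTn => ?_⟩
  classical
  have hex : ∃ m, T ≤ (Λ m).card := ⟨n, hTn⟩
  refine ⟨Nat.find hex, Nat.find_min' hex hTn, Nat.find_spec hex, ?_⟩
  have hT0 : 0 ≤ T := by linarith
  rcases Nat.eq_zero_or_pos (Nat.find hex) with h0 | hpos
  · rw [h0]
    calc ((Λ 0).card : ℝ) ≤ (Λ 0).card * T := le_mul_of_one_le_right (by positivity) hT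
      _ ≤ _ := mul_le_mul_of_nonneg_right ((le_max_right _ _).trans (le_max_left _ _)) hT0
  · obtain ⟨i, hi⟩ : ∃ i, Nat.find hex = i + 1 := ⟨Nat.find hex - 1, by omega⟩
    have hlt : ((Λ i).card : ℝ) < T := by
      have := Nat.find_min hex (by omega : i < Nat.find hex)
      exact not_le.1 this
    rw [hi]
    calc ((Λ (i + 1)).card : ℝ) ≤ c * (Λ i).card := hc i
      _ ≤ max (max c (Λ 0).card) 1 * (Λ i).card :=
          mul_le_mul_of_nonneg_right ((le_max_left _ _).trans (le_max_left _ _)) (by positivity)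
      _ ≤ _ := mul_le_mul_of_nonneg_left hlt.le (zero_le_one.trans (le_max_right _ _))

theorem measurable_deviation {ι : Type*} [Fintype ι] [DecidableEq ι] (α : ℝ) {m : ℝ → ℝ}
    (hm : Continuous m) : Measurable fun J : ι → ι → ℝ => deviation J α m := by
  simp only [deviation_eq_iSup]
  exact Measurable.iSup fun K => measurable_deviationUpTo α hm K

theorem aemeasurable_deviation (hJ : IsShiftInvariantDisorder μ J) (R : Finset (Site D q)) (α : ℝ)
    {m : ℝ → ℝ} (hm : Continuous m) :
    AEMeasurable (fun ω => deviation (restrictCouplings J R ω) α m) μ :=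
  (measurable_deviation α hm).comp_aemeasurable (aemeasurable_restrictCouplings hJ R)

theorem lintegral_deviation_sq_le (hJ : IsShiftInvariantDisorder μ J) (R : Finset (Site D q))
    (α : ℝ) {m : ℝ → ℝ} (hm : Continuous m) {b : ℝ≥0∞}
    (hb : ∀ K, ∫⁻ ω, deviationUpTo (restrictCouplings J R ω) α m K ^ 2 ∂μ ≤ b) :
    ∫⁻ ω, deviation (restrictCouplings J R ω) α m ^ 2 ∂μ ≤ b := by
  have h1 (ω) : deviation (restrictCouplings J R ω) α m ^ 2 =
      ⨆ K, deviationUpTo (restrictCouplings J R ω) α m K ^ 2 := by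
    rw [deviation_eq_iSup, ENNReal.iSup_pow]
  have h2 (K : ℕ) : AEMeasurable
      (fun ω => deviationUpTo (restrictCouplings J R ω) α m K ^ 2) μ :=
    ((measurable_deviationUpTo α hm K).comp_aemeasurable
      (aemeasurable_restrictCouplings hJ R)).pow_const 2
  simp only [h1]
  rw [lintegral_iSup' h2 (Eventually.of_forall fun ω K L hKL =>
    pow_le_pow_left' (monotone_deviationUpTo _ α m hKL) 2)]
  exact iSup_le hb

variable [IsProbabilityMeasure μ]

/-- The mean square deviation is of the order `N ^ (-2 / (5 D))`. -/
theorem exists_lintegral_deviation_sq_le (hD : 2 ≤ D) (hJ : IsShiftInvariantDisorder μ J)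
    (hΛ : IsFiniteDimensional μ J Λ) {c cs cr : ℝ}
    (hΛ' : FiniteDimensionalWith μ J Λ c cs cr) {e : ℝ → ℝ} (he : IsLimitDensity μ J Λ c cs e)
    {α : ℝ} (hα : 0 < α) {mS : ℝ → ℝ} (hself : ∀ γ, IsSelfConsistent e α γ (mS γ))
    (hmS : ∀ γ, |mS γ| ≤ 1) (hcont : Continuous mS) :
    ∃ C : ℝ, 0 ≤ C ∧ ∀ n, ∫⁻ ω, deviation (restrictCouplings J (Λ n) ω) α mS ^ 2 ∂μ ≤
      ENNReal.ofReal (C * ((Λ n).card : ℝ) ^ (-(2 / (5 * (D : ℝ))))) := by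
  obtain ⟨C₀, hC₀, hbetween⟩ := hΛ.exists_card_between
  have hD2 : (2 : ℝ) ≤ D := by exact_mod_cast hD
  have hD0 : (0 : ℝ) < D := by linarith
  have hc0 := hΛ'.c_nonneg
  have hcs0 := hΛ'.cs_nonneg
  have hcr0 := hΛ'.cr_nonneg
  refine ⟨α⁻¹ * (3 * c ^ 2 * C₀ + 1 + 4 * cs + 4 * (c * (cr * C₀)) + 2 * (2 * c + 4 * α) +
    12 * α * C₀), by positivity, fun n => lintegral_deviation_sq_le hJ _ α hcont fun Γ => ?_⟩
  set N : ℝ := ((Λ n).card : ℝ) with hN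
  have hN1 : 1 ≤ N := by rw [hN]; exact_mod_cast (hΛ.nonempty n).card_pos
  have hN0 : 0 < N := by linarith
  set δ : ℝ := N ^ (-(2 / (5 * (D : ℝ)))) with hδ
  have hδ0 : 0 < δ := by positivity
  have hδ1 : δ ≤ 1 := Real.rpow_le_one_of_one_le_of_nonpos hN1 (by
    rw [neg_nonpos]; positivity)
  set T : ℝ := N ^ (2 / 5 : ℝ) with hT
  have hT1 : 1 ≤ T := Real.one_le_rpow hN1 (by norm_num)
  have hTN : T ≤ N := by
    calc T ≤ N ^ (1 : ℝ) := Real.rpow_le_rpow_of_exponent_le hN1 (by norm_num)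
      _ = N := Real.rpow_one N
  obtain ⟨m, hmn, hTA, hAT⟩ := hbetween n T hT1 hTN
  obtain ⟨V, hV⟩ := hΛ'.decomposition m n hmn
  have hrem := hV.rem
  set A : ℝ := ((Λ m).card : ℝ) with hA
  rw [← hN] at hrem
  set r : ℝ := ((Λ n \ V.biUnion fun v => translateRegion v (Λ m)).card : ℝ) with hr
  set s : ℝ := A ^ (-(1 / (D : ℝ))) with hs
  have hT0 : 0 < T := by linarith
  have hA0 : 0 < A := by linarith
  have hTδ : T ^ (-(1 / (D : ℝ))) = δ := by
    rw [hT, hδ, ← Real.rpow_mul hN0.le]; congr 1; field_simp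
  have hsδ : s ≤ δ := by
    rw [← hTδ]
    exact Real.rpow_le_rpow_of_nonpos hT0 hTA (by rw [neg_nonpos]; positivity)
  have hTδ3 : T ≤ N * δ ^ 3 := by
    have h1 : N * δ ^ 3 = N ^ (1 + -(2 / (5 * (D : ℝ))) * 3) := by
      rw [Real.rpow_add hN0, Real.rpow_one, Real.rpow_mul hN0.le, ← hδ]
      norm_cast
    rw [h1, hT]
    refine Real.rpow_le_rpow_of_exponent_le hN1 ?_
    have h2 : 2 / (5 * (D : ℝ)) ≤ 1 / 5 := by
      rw [div_le_div_iff₀ (by positivity) (by norm_num)]; linarith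
    linarith
  have hA3 : A ≤ C₀ * (N * δ ^ 3) :=
    hAT.trans (mul_le_mul_of_nonneg_left hTδ3 (by linarith))
  have hδ31 : δ ^ 3 ≤ δ := by
    calc δ ^ 3 ≤ δ ^ 1 := pow_le_pow_of_le_one hδ0.le hδ1 (by norm_num)
      _ = δ := pow_one δ
  have hAδ : A ≤ C₀ * (N * δ) := hA3.trans (by gcongr)
  have hρ : (A / N) ^ (1 / (D : ℝ)) ≤ C₀ * δ := by
    have h1 : A / N ≤ C₀ * (T⁻¹) := by
      rw [div_le_iff₀ hN0]
      refine hAT.trans ?_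
      rw [mul_assoc]
      refine mul_le_mul_of_nonneg_left ?_ (by linarith)
      rw [inv_mul_eq_div, le_div_iff₀ hT0]
      calc T * T = N ^ (2 / 5 + 2 / 5 : ℝ) := (Real.rpow_add hN0 _ _).symm
        _ ≤ N ^ (1 : ℝ) := Real.rpow_le_rpow_of_exponent_le hN1 (by norm_num)
        _ = N := Real.rpow_one N
    have h2 : 1 / (D : ℝ) ≤ 1 := by rw [div_le_one hD0]; linarith
    calc (A / N) ^ (1 / (D : ℝ)) ≤ (C₀ * T⁻¹) ^ (1 / (D : ℝ)) :=
          Real.rpow_le_rpow (by positivity) h1 (by positivity)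
      _ = C₀ ^ (1 / (D : ℝ)) * δ := by
          rw [Real.mul_rpow (by linarith) (by positivity), Real.inv_rpow hT0.le,
            ← Real.rpow_neg hT0.le, hTδ]
      _ ≤ C₀ * δ := by
          refine mul_le_mul_of_nonneg_right ?_ hδ0.le
          calc C₀ ^ (1 / (D : ℝ)) ≤ C₀ ^ (1 : ℝ) := Real.rpow_le_rpow_of_exponent_le hC₀ h2
            _ = C₀ := Real.rpow_one C₀
  have hrδ : c * r ≤ c * (cr * C₀) * (N * δ) := by
    have h1 : r ≤ cr * (C₀ * δ * N) := hrem.trans (by gcongr)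
    calc c * r ≤ c * (cr * (C₀ * δ * N)) := mul_le_mul_of_nonneg_left h1 hc0
      _ = _ := by ring
  set K : ℕ := ⌈1 / δ⌉₊ with hK
  have hKpos : 0 < K := Nat.ceil_pos.2 (by positivity)
  have hK0 : (0 : ℝ) < K := by exact_mod_cast hKpos
  have hK1 : 1 / δ ≤ K := Nat.le_ceil _
  have hK2 : (K : ℝ) + 1 ≤ 3 / δ := by
    have h1 : (K : ℝ) < 1 / δ + 1 := Nat.ceil_lt_add_one (by positivity)
    have h2 : 1 ≤ 1 / δ := by rw [le_div_iff₀ hδ0]; linarith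
    have h3 : 3 / δ = 1 / δ + 1 / δ + 1 / δ := by ring
    linarith
  have h1K : 1 / (K : ℝ) ≤ δ := by
    rw [div_le_iff₀ hK0]; rw [div_le_iff₀ hδ0] at hK1; linarith
  refine (lintegral_deviationUpTo_sq_le hJ hΛ' he hα hself hmS hV hA hN hs hr hKpos hδ0 Γ).trans
    (ENNReal.ofReal_le_ofReal ?_)
  have t1 : (K + 1) * (c ^ 2 * A * N) / (N * δ) ≤ 3 * c ^ 2 * C₀ * (N * δ) := by
    calc (K + 1) * (c ^ 2 * A * N) / (N * δ)
        ≤ (3 / δ) * (c ^ 2 * (C₀ * (N * δ ^ 3)) * N) / (N * δ) := by gcongr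
      _ = 3 * c ^ 2 * C₀ * (N * δ) := by field_simp
  have t2 : cs * s * N ≤ cs * (N * δ) := by
    have := mul_le_mul_of_nonneg_left hsδ (mul_nonneg hcs0 hN0.le)
    linarith
  have t3 : N * (2 * c + 4 * α) / K ≤ (2 * c + 4 * α) * (N * δ) := by
    have h1 := mul_le_mul_of_nonneg_left h1K
      (show 0 ≤ N * (2 * c + 4 * α) by positivity)
    rw [mul_one_div] at h1
    linarith
  have t4 : 6 * α * (A + 1) ≤ 12 * α * C₀ * (N * δ) := by
    have h1 : A + 1 ≤ 2 * (C₀ * (N * δ)) := by linarith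
    have := mul_le_mul_of_nonneg_left h1 (show 0 ≤ 6 * α by positivity)
    linarith
  rw [mul_inv, mul_assoc α⁻¹, mul_assoc α⁻¹]
  refine mul_le_mul_of_nonneg_left ?_ (inv_nonneg.2 hα.le)
  rw [inv_mul_le_iff₀ hN0]
  linarith

end Rate

end QAAFF

theorem theorem1 {D q : ℕ} (hD : 2 ≤ D) {Ω : Type*} [MeasurableSpace Ω] (μ : Measure Ω)
    [IsProbabilityMeasure μ] (J : QAAFF.Site D q → QAAFF.Site D q → Ω → ℝ)
    (Λ : ℕ → Finset (QAAFF.Site D q)) (hJ : QAAFF.IsShiftInvariantDisorder μ J)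
    (hΛ : QAAFF.IsFiniteDimensional μ J Λ) :
    -- `e` is the limit of the mean ground-state energy density of `U - γ M`,
    -- `u` its inverse Legendre transform on `[-1, 1]`
    ∃ e u : ℝ → ℝ,
      (∀ n γ, Integrable
        (fun ω => QAAFF.groundEnergy (QAAFF.annealHam (QAAFF.restrictCouplings J (Λ n) ω) γ 0)) μ) ∧
      (∀ γ, Tendsto
        (fun n => (∫ ω, QAAFF.groundEnergy (QAAFF.annealHam (QAAFF.restrictCouplings J (Λ n) ω) γ 0) ∂μ) /
          ((Λ n).card : ℝ)) atTop (𝓝 (e γ))) ∧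
      (∀ m ∈ Set.Icc (-1 : ℝ) 1, IsLUB (Set.range fun γ : ℝ => e γ + γ * m) (u m)) ∧
      ∀ α : ℝ, 0 < α →
        -- `mStar γ` is the unique minimizer of `u m + α m² - γ m`
        (∃ mStar : ℝ → ℝ, Continuous mStar ∧
          (∀ γ, mStar γ ∈ Set.Icc (-1 : ℝ) 1 ∧ ∀ m ∈ Set.Icc (-1 : ℝ) 1, m ≠ mStar γ →
            u (mStar γ) + α * mStar γ ^ 2 - γ * mStar γ < u m + α * m ^ 2 - γ * m) ∧
          (∀ n, AEMeasurable
            (fun ω => QAAFF.deviation (QAAFF.restrictCouplings J (Λ n) ω) α mStar) μ) ∧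
          ∀ ε : ℝ, 0 < ε → ∃ C : ℝ, ∀ n,
            (∫⁻ ω, QAAFF.deviation (QAAFF.restrictCouplings J (Λ n) ω) α mStar ^ 2 ∂μ) ^ (1 / 2 : ℝ) ≤
              ENNReal.ofReal (C * ((Λ n).card : ℝ) ^ (-1 / (5 * (D : ℝ)) + ε))) ∧
        QAAFF.NoQFOT μ J Λ α := by
  have hD0 : (0 : ℝ) < D := by exact_mod_cast (by omega : 0 < D)
  obtain ⟨c, cs, cr, hΛ'⟩ := hΛ.exists_with
  obtain ⟨e, he⟩ := QAAFF.exists_isLimitDensity (by omega) hJ hΛ'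
  have hle (γ) : e γ ≤ c - |γ| := by linarith [(abs_le.1 (he.abs_add_le γ)).2]
  have hlub : ∀ m ∈ Set.Icc (-1 : ℝ) 1,
      IsLUB (Set.range fun γ : ℝ => e γ + γ * m) (⨆ γ : ℝ, e γ + γ * m) := by
    intro m hm
    refine isLUB_ciSup ⟨c, ?_⟩
    rintro _ ⟨γ, rfl⟩
    have h1 : γ * m ≤ |γ| := by
      refine (le_abs_self _).trans ?_
      rw [abs_mul]
      exact mul_le_of_le_one_right (abs_nonneg _) (abs_le.2 hm)
    dsimp only
    linarith [hle γ]
  refine ⟨e, fun m => ⨆ γ : ℝ, e γ + γ * m, fun n γ => QAAFF.integrable_energy hJ (Λ n) γ,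
    he.tendsto, hlub, fun α hα => ?_⟩
  choose mS hself using QAAFF.exists_isSelfConsistent he.concaveOn he.continuous
    (fun γ => (hle γ).trans (sub_le_self c (abs_nonneg γ))) hα
  have hmem (γ) : mS γ ∈ Set.Icc (-1 : ℝ) 1 := (hself γ).mem_Icc he.abs_add_le
  have hcont : Continuous mS := QAAFF.continuous_of_isSelfConsistent hα hself
  have hmeas (n) := QAAFF.aemeasurable_deviation hJ (Λ n) α hcont
  obtain ⟨C, hC0, hC⟩ := QAAFF.exists_lintegral_deviation_sq_le hD hJ hΛ hΛ' he hα hself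
    (fun γ => abs_le.2 (hmem γ)) hcont
  refine ⟨⟨mS, hcont, fun γ => ⟨hmem γ, fun m hm hne =>
    (hself γ).lt hα hlub (hmem γ) hm hne⟩, hmeas, fun ε hε => ⟨Real.sqrt C, fun n => ?_⟩⟩,
    mS, hcont.continuousOn, hmeas, ?_⟩
  · have hN1 : (1 : ℝ) ≤ (Λ n).card := by exact_mod_cast (hΛ.nonempty n).card_pos
    set N : ℝ := ((Λ n).card : ℝ)
    calc _ ≤ ENNReal.ofReal (C * N ^ (-(2 / (5 * (D : ℝ))))) ^ (1 / 2 : ℝ) :=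
          ENNReal.rpow_le_rpow (hC n) (by norm_num)
      _ = ENNReal.ofReal (Real.sqrt C * N ^ (-1 / (5 * (D : ℝ)))) := by
          rw [ENNReal.ofReal_rpow_of_nonneg (by positivity) (by norm_num),
            Real.mul_rpow hC0 (by positivity), ← Real.sqrt_eq_rpow, ← Real.rpow_mul (by positivity)]
          congr 3
          field_simp
      _ ≤ _ := by
          refine ENNReal.ofReal_le_ofReal (mul_le_mul_of_nonneg_left ?_ (Real.sqrt_nonneg _))
          exact Real.rpow_le_rpow_of_exponent_le hN1 (by linarith)
  · have h1 : Tendsto (fun n => ENNReal.ofReal (C * ((Λ n).card : ℝ) ^ (-(2 / (5 * (D : ℝ))))))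
        atTop (𝓝 0) := by
      have h2 : Tendsto (fun n => C * ((Λ n).card : ℝ) ^ (-(2 / (5 * (D : ℝ))))) atTop (𝓝 0) := by
        simpa using ((tendsto_rpow_neg_atTop (show (0 : ℝ) < 2 / (5 * D) by positivity)).comp
          (tendsto_natCast_atTop_atTop.comp hΛ.card_tendsto)).const_mul C
      simpa using ENNReal.tendsto_ofReal h2
    exact tendsto_of_tendsto_of_tendsto_of_le_of_le tendsto_const_nhds h1
      (fun _ => zero_le) hC
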